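/- **Theorem.** Let $n\ge 0$ be an integer, and let $B_n$ be the group (under composition) of the permutations $\sigma$ of $\pm[n]=\{\pm1,\dots,\pm n\}$ with $\sigma(-k)=-\sigma(k)$ for all $k$, with simple generators $s_0=(1\ \,{-1})$ and $s_i=(i\ \,i{+}1)({-i}\ \,{-(i{+}1)})$ for $1\le i\le n-1$. Let $\ell(w)$ be the minimal length of a word in the simple generators representing $w$ (such a minimal word is called reduced), and put $\mathrm{Des}(w)=\{i:\ell(s_iw)<\ell(w)\}\subseteq[0,n-1]$. Write $x\le_{\mathsf L}y$ (left weak order) if some reduced word for $y$ has a reduced word for $x$ as a suffix; a set $X\subseteq B_n$ is *convex* if $x,y\in X$ and $x\le_{\mathsf L}z\le_{\mathsf L}y$ imply $z\in X$. A set $X\subseteq B_n$ is *ascent-compatible* if for all $u,v\in X$ and all $i,j\in[0,n-1]$ with $i\notin\mathrm{Des}(u)$, $j\notin\mathrm{Des}(v)$ and $u^{-1}s_iu=v^{-1}s_jv$, we have $s_iu\in X$ if and only if $s_jv\in X$. Let $\mathcal A_n^B\subseteq B_n$ be the set of *signed arc permutations*: those $\sigma$ whose one-line notation $\sigma(1)\cdots\sigma(n)$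 is a shuffle of a word $a_1\cdots a_p$ over $[n]$ and a word $b_1\cdots b_{n-p}$ over $-[n]$ such that $a_{i+1}\equiv a_i+1$ and $b_{j+1}\equiv b_j+1\pmod n$ for all $1\le i\le p-1$ and $1\le j\le n-p-1$, and $a_1\equiv -b_1+1\pmod n$ if both words are nonempty. Let $H_n^B(0)$ be the $\mathbb C$-algebra generated by $\pi_0,\dots,\pi_{n-1}$ with relations $\pi_i^2=-\pi_i$; $\pi_i\pi_j=\pi_j\pi_i$ for $|i-j|\ge2$; $\pi_i\pi_{i+1}\pi_i=\pi_{i+1}\pi_i\pi_{i+1}$ for $1\le i\le n-2$; and $\pi_0\pi_1\pi_0\pi_1=\pi_1\pi_0\pi_1\pi_0$ (if $n\ge 2$). For $I\subseteq[0,n-1]$ let $\mathcal S_I^B$ be the one-dimensional $H_n^B(0)$-module on which $\pi_j$ acts as $-1$ if $j\in I$ and as $0$ if $j\notin I$, and let $$F_I^B=\sum_{\substack{0=i_0\le i_1\le\cdots\le i_n\\ j\in I\Rightarrow i_j<i_{j+1}}}x_{i_1}\cdots x_{i_n}.$$ Let $\mathrm{ch}^B$ be the homomorphism from the Grothendieck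 group of finite-dimensional $H_n^B(0)$-modules (the free abelian group on isomorphism classes modulo $[M]-[N]+[P]=0$ for short exact sequences $0\to M\to N\to P\to0$) to formal power series in $x_0,x_1,\dots$ with $\mathrm{ch}^B([\mathcal S_I^B])=F_I^B$ for all $I$. For $X\subseteq B_n$ let $\mathcal Q(X)=\sum_{x\in X}F^B_{\mathrm{Des}(x^{-1})}$ and $X^{-1}=\{x^{-1}:x\in X\}$. Then: 1. $\mathcal A_n^B$ is ascent-compatible. 2. If $n\ge3$, then $\mathcal A_n^B$ is not convex in the left weak order. 3. The complex vector space $\mathbb C\mathcal A_n^B$ with basis $\mathcal A_n^B$ is an $H_n^B(0)$-module under the action determined, for $x\in\mathcal A_n^B$, by $$\pi_i\,x=\begin{cases}-x&\text{if } i\in\mathrm{Des}(x),\\ 0&\text{if } i\notin\mathrm{Des}(x)\text{ and } s_ix\notin\mathcal A_n^B,\\ s_ix&\text{if } i\notin\mathrm{Des}(x)\text{ and } s_ix\in\mathcal A_n^B,\end{cases}$$ and $\mathrm{ch}^B(\mathbb C\mathcal A_n^B)=\mathcal Q((\mathcal A_n^B)^{-1})$. -/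

import Mathlib

open scoped Pointwise

noncomputable section

/-! ### Words, length, descents and the left weak order

`s : ι → W` is the family of simple generators of a group `W`. -/

section Coxeter

variable {W ι : Type*} [Group W] (s : ι → W)

/-- The length of `w`: the minimal number of letters in a word over the simple generators that
represents `w`. -/
def wordLength (w : W) : ℕ :=
  sInf {k | ∃ l : List ι, l.length = k ∧ (l.map s).prod = w}

/-- The word `l` is a reduced word for `w`. -/
def IsReducedWord (l : List ι) (w : W) : Prop :=
  (l.map s).prod = w ∧ l.length = wordLength s w

/-- The set `Des(w)` of (left) descents of `w`. -/
def Des (w : W) : Set ι :=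
  {i | wordLength s (s i * w) < wordLength s w}

/-- `x ≤_L y`: some reduced word for `y` has a reduced word for `x` as a suffix. -/
def LeftWeakLE (x y : W) : Prop :=
  ∃ l₁ l₂ : List ι, IsReducedWord s (l₁ ++ l₂) y ∧ IsReducedWord s l₂ x

/-- Convexity in the left weak order. -/
def LeftWeakConvex (X : Set W) : Prop :=
  ∀ x ∈ X, ∀ y ∈ X, LeftWeakLE s x y → ∀ z, LeftWeakLE s x z → LeftWeakLE s z y → z ∈ X

/-- The quadruple `(u, v, s i, s j)` is aligned. -/
def Aligned (u v : W) (i j : ι) : Prop :=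
  i ∉ Des s u ∧ j ∉ Des s v ∧ u⁻¹ * s i * u = v⁻¹ * s j * v

/-- `X` is ascent-compatible. -/
def AscentCompatible (X : Set W) : Prop :=
  ∀ u ∈ X, ∀ v ∈ X, ∀ i j : ι, Aligned s u v i j → (s i * u ∈ X ↔ s j * v ∈ X)

open Classical in
/-- The linear operator `π_i` on `ℂX`, the vector space with basis `X`. -/
def piOp (X : Set W) (i : ι) : Module.End ℂ (X →₀ ℂ) :=
  Finsupp.linearCombination ℂ fun x : X =>
    if i ∈ Des s (x : W) then -Finsupp.single x (1 : ℂ)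
    else if h : s i * (x : W) ∈ X then Finsupp.single (⟨s i * (x : W), h⟩ : X) (1 : ℂ)
    else 0

end Coxeter

/-! ### The hyperoctahedral group -/

/-- The set `±[n] = {±1, …, ±n}`. -/
abbrev PM (n : ℕ) : Type := {k : ℤ // k ∈ (Finset.Icc (-(n : ℤ)) n).erase 0}

namespace PM

instance (n : ℕ) : Neg (PM n) :=
  ⟨fun k => ⟨-k.1, by have := k.2; simp only [Finset.mem_erase, Finset.mem_Icc] at *; omega⟩⟩

theorem coe_neg {n : ℕ} (k : PM n) : ((-k : PM n) : ℤ) = -(k : ℤ) := rfl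

theorem neg_neg {n : ℕ} (k : PM n) : - -k = k := Subtype.ext (by simp [coe_neg])

/-- The element `j + 1` of `[n]`, for `0 ≤ j < n`. -/
def pos {n : ℕ} (j : Fin n) : PM n :=
  ⟨(j : ℤ) + 1, by have := j.2; simp only [Finset.mem_erase, Finset.mem_Icc]; omega⟩

end PM

/-- The hyperoctahedral group `B_n`: the permutations `σ` of `±[n]` with `σ(-k) = -σ(k)`. -/
def hyperoctahedralGroup (n : ℕ) : Subgroup (Equiv.Perm (PM n)) where
  carrier := {σ | ∀ k, σ (-k) = -σ k}
  mul_mem' := by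
    intro a b ha hb k
    simp only [Set.mem_ofPred_eq] at ha hb
    simp [Equiv.Perm.mul_apply, ha, hb]
  one_mem' := fun _ => rfl
  inv_mem' := by
    intro a ha k
    simp only [Set.mem_ofPred_eq] at ha
    rw [Equiv.Perm.inv_eq_iff_eq, ha]
    simp

/-- The underlying permutation of the simple generator `s_i` of `B_n`: `s_0 = (1 -1)` and
`s_i = (i  i+1)(-i  -(i+1))` for `1 ≤ i ≤ n - 1`. -/
def simplePerm {n : ℕ} (i : Fin n) : Equiv.Perm (PM n) :=
  if (i : ℕ) = 0 then Equiv.swap (PM.pos i) (-PM.pos i)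
  else
    let p : Fin n := ⟨(i : ℕ) - 1, lt_of_le_of_lt (Nat.sub_le _ _) i.2⟩
    Equiv.swap (PM.pos p) (PM.pos i) * Equiv.swap (-PM.pos p) (-PM.pos i)

theorem simplePerm_neg {n : ℕ} (i : Fin n) (k : PM n) :
    simplePerm i (-k) = -simplePerm i k := by
  have hk := k.2
  have hi := i.2
  simp only [Finset.mem_erase, Finset.mem_Icc] at hk
  unfold simplePerm
  split_ifs with h <;>
  · apply Subtype.ext
    simp only [Equiv.Perm.mul_apply, Equiv.swap_apply_def, Subtype.ext_iff, PM.coe_neg, PM.pos,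
      apply_ite Subtype.val]
    split_ifs <;> omega

/-- The simple generators `s_0, …, s_{n-1}` of `B_n`. -/
def simpleB (n : ℕ) (i : Fin n) : hyperoctahedralGroup n :=
  ⟨simplePerm i, simplePerm_neg i⟩

/-! ### Signed arc permutations -/

/-- The one-line notation `σ(1) ⋯ σ(n)`. -/
def oneLine {n : ℕ} (σ : hyperoctahedralGroup n) : List ℤ :=
  List.ofFn fun j : Fin n => ((σ : Equiv.Perm (PM n)) (PM.pos j) : ℤ)

/-- `w` is a shuffle of the words `a` and `b` (which use disjoint sets of letters). -/
def IsShuffle (a b w : List ℤ) : Prop :=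
  w.filter (fun x => x ∉ b) = a ∧ w.filter (fun x => x ∉ a) = b

/-- The set `A_n^B` of signed arc permutations. -/
def signedArc (n : ℕ) : Set (hyperoctahedralGroup n) :=
  {σ | ∃ a b : List ℤ,
    (∀ x ∈ a, 1 ≤ x ∧ x ≤ n) ∧ (∀ y ∈ b, -(n : ℤ) ≤ y ∧ y ≤ -1) ∧
    IsShuffle a b (oneLine σ) ∧
    a.IsChain (fun x x' => x' ≡ x + 1 [ZMOD n]) ∧
    b.IsChain (fun y y' => y' ≡ y + 1 [ZMOD n]) ∧
    ∀ x ∈ a.head?, ∀ y ∈ b.head?, x ≡ -y + 1 [ZMOD n]}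

/-! ### The type-B 0-Hecke algebra -/

/-- The defining relations of `H_n^B(0)`. -/
inductive HeckeBRel (n : ℕ) : FreeAlgebra ℂ (Fin n) → FreeAlgebra ℂ (Fin n) → Prop
  | quad (i : Fin n) :
      HeckeBRel n (FreeAlgebra.ι ℂ i * FreeAlgebra.ι ℂ i) (-FreeAlgebra.ι ℂ i)
  | comm (i j : Fin n) (h : (i : ℕ) + 2 ≤ j) :
      HeckeBRel n (FreeAlgebra.ι ℂ i * FreeAlgebra.ι ℂ j)
        (FreeAlgebra.ι ℂ j * FreeAlgebra.ι ℂ i)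
  | braid (i j : Fin n) (hi : 1 ≤ (i : ℕ)) (h : (j : ℕ) = i + 1) :
      HeckeBRel n (FreeAlgebra.ι ℂ i * FreeAlgebra.ι ℂ j * FreeAlgebra.ι ℂ i)
        (FreeAlgebra.ι ℂ j * FreeAlgebra.ι ℂ i * FreeAlgebra.ι ℂ j)
  | braid₄ (i j : Fin n) (hi : (i : ℕ) = 0) (hj : (j : ℕ) = 1) :
      HeckeBRel n
        (FreeAlgebra.ι ℂ i * FreeAlgebra.ι ℂ j * FreeAlgebra.ι ℂ i * FreeAlgebra.ι ℂ j)
        (FreeAlgebra.ι ℂ j * FreeAlgebra.ι ℂ i * FreeAlgebra.ι ℂ j * FreeAlgebra.ι ℂ i)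

/-- The type-B 0-Hecke algebra `H_n^B(0)` over `ℂ`. -/
abbrev HeckeB (n : ℕ) : Type := RingQuot (HeckeBRel n)

/-- The generator `π_i` of `H_n^B(0)`. -/
def HeckeB.gen {n : ℕ} (i : Fin n) : HeckeB n :=
  RingQuot.mkAlgHom ℂ (HeckeBRel n) (FreeAlgebra.ι ℂ i)

open Classical in
/-- The character of `H_n^B(0)` through which it acts on the simple module `S_I^B`:
`π_j ↦ -1` if `j ∈ I`, and `π_j ↦ 0` otherwise. -/
def HeckeB.simpleChar {n : ℕ} (I : Set (Fin n)) : HeckeB n →ₐ[ℂ] ℂ :=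
  RingQuot.liftAlgHom ℂ ⟨FreeAlgebra.lift ℂ fun j => if j ∈ I then (-1 : ℂ) else 0, by
    intro x y h
    cases h <;> simp only [map_mul, map_neg, FreeAlgebra.lift_ι_apply] <;> split_ifs <;> norm_num⟩

open Classical in
theorem HeckeB.simpleChar_gen {n : ℕ} (I : Set (Fin n)) (j : Fin n) :
    HeckeB.simpleChar I (HeckeB.gen j) = if j ∈ I then (-1 : ℂ) else 0 := by
  simp [HeckeB.simpleChar, HeckeB.gen]

/-! ### Finite-dimensional modules and the Grothendieck group -/

/-- A finite-dimensional (left) module over a `ℂ`-algebra `A`. -/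
structure FDModule (A : Type) [Ring A] [Algebra ℂ A] : Type 1 where
  carrier : Type
  [addCommGroup : AddCommGroup carrier]
  [moduleC : Module ℂ carrier]
  [module : Module A carrier]
  [isScalarTower : IsScalarTower ℂ A carrier]
  [finite : Module.Finite ℂ carrier]

attribute [instance] FDModule.addCommGroup FDModule.moduleC FDModule.module
  FDModule.isScalarTower FDModule.finite

section Grothendieck

variable (A : Type) [Ring A] [Algebra ℂ A]

variable {A} in
/-- The module given by a representation `ρ : A → End(V)`, that is, `a • v = ρ(a)(v)`. -/
def FDModule.ofRep {V : Type} [AddCommGroup V] [Module ℂ V] [Module.Finite ℂ V]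
    (ρ : A →ₐ[ℂ] Module.End ℂ V) : FDModule A :=
  letI : Module A V := Module.compHom V ρ.toRingHom
  haveI : IsScalarTower ℂ A V := ⟨fun c a v => by
    change ρ (c • a) v = c • ρ a v
    rw [map_smul, LinearMap.smul_apply]⟩
  { carrier := V }

/-- The elements `[M] - [N] + [P]` for the short exact sequences `0 → M → N → P → 0`. -/
def shortExactRelators : Set (FreeAbelianGroup (FDModule A)) :=
  {z | ∃ (M N P : FDModule A) (f : M.carrier →ₗ[A] N.carrier) (g : N.carrier →ₗ[A] P.carrier),
    Function.Injective f ∧ Function.Exact f g ∧ Function.Surjective g ∧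
    z = FreeAbelianGroup.of M - FreeAbelianGroup.of N + FreeAbelianGroup.of P}

/-- The Grothendieck group of finite-dimensional `A`-modules. (Isomorphic modules are identified
by the relators with `P = 0`.) -/
abbrev GrothendieckGroup₀ : Type 1 :=
  FreeAbelianGroup (FDModule A) ⧸ AddSubgroup.closure (shortExactRelators A)

variable {A} in
/-- The class `[M]` in the Grothendieck group. -/
def FDModule.cls (M : FDModule A) : GrothendieckGroup₀ A :=
  QuotientAddGroup.mk (FreeAbelianGroup.of M)

end Grothendieck

/-- The one-dimensional simple `H_n^B(0)`-module `S_I^B`. -/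
def simpleModuleB {n : ℕ} (I : Set (Fin n)) : FDModule (HeckeB n) :=
  FDModule.ofRep ((Algebra.lmul ℂ ℂ).comp (HeckeB.simpleChar I))

/-! ### Type-B quasisymmetric functions and the characteristic map -/

/-- The sequences `0 = i_0 ≤ i_1 ≤ ⋯ ≤ i_n` with `i_j < i_{j+1}` for all `j ∈ I`. -/
def admissibleSeq {n : ℕ} (I : Set (Fin n)) : Set (Fin (n + 1) → ℕ) :=
  {i | i 0 = 0 ∧ Monotone i ∧ ∀ j ∈ I, i j.castSucc < i j.succ}

/-- The type-B fundamental quasisymmetric function `F_I^B = ∑ x_{i_1} ⋯ x_{i_n}`, summed over the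
admissible sequences, as a formal power series in `x_0, x_1, …`: the coefficient of a monomial is
the number of admissible sequences that produce it. -/
def fundamentalB {n : ℕ} (I : Set (Fin n)) : MvPowerSeries ℕ ℂ := fun d =>
  (Set.ncard {i ∈ admissibleSeq I | ∑ j : Fin n, Finsupp.single (i j.succ) 1 = d} : ℂ)

/-- `𝒬(X) = ∑_{x ∈ X} F^B_{Des(x⁻¹)}`. -/
def QB {n : ℕ} (X : Set (hyperoctahedralGroup n)) : MvPowerSeries ℕ ℂ :=
  ∑ᶠ x ∈ X, fundamentalB (Des (simpleB n) x⁻¹)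

/-- The trace of the action of `a` is additive on short exact sequences. -/
theorem trace_shortExact {A : Type} [Ring A] [Algebra ℂ A] {M N P : FDModule A}
    (f : M.carrier →ₗ[A] N.carrier) (g : N.carrier →ₗ[A] P.carrier)
    (hf : Function.Injective f) (hfg : Function.Exact f g) (hg : Function.Surjective g) (a : A) :
    LinearMap.trace ℂ N.carrier (Algebra.lsmul ℂ ℂ N.carrier a) =
      LinearMap.trace ℂ M.carrier (Algebra.lsmul ℂ ℂ M.carrier a) +
      LinearMap.trace ℂ P.carrier (Algebra.lsmul ℂ ℂ P.carrier a) := by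
  let f' : M.carrier →ₗ[ℂ] N.carrier := f.restrictScalars ℂ
  let g' : N.carrier →ₗ[ℂ] P.carrier := g.restrictScalars ℂ
  obtain ⟨r, hr⟩ := f'.exists_leftInverse_of_injective (LinearMap.ker_eq_bot.2 hf)
  obtain ⟨q, hq⟩ := g'.exists_rightInverse_of_surjective (LinearMap.range_eq_top.2 hg)
  have hr' : ∀ x, r (f x) = x := fun x => LinearMap.congr_fun hr x
  have hq' : ∀ x, g (q x) = x := fun x => LinearMap.congr_fun hq x
  let r' : N.carrier →ₗ[ℂ] M.carrier := r ∘ₗ (LinearMap.id - q ∘ₗ g')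
  have hsplit : ∀ x, f (r' x) + q (g x) = x := by
    intro x
    obtain ⟨y, hy⟩ := (hfg (x - q (g x))).1 (by rw [map_sub, hq', sub_self])
    have : r' x = y := by
      change r (x - q (g x)) = y
      rw [← hy, hr']
    rw [this, hy, sub_add_cancel]
  have hr'f : ∀ x, r' (f x) = x := by
    intro x
    change r (f x - q (g (f x))) = x
    rw [hfg.apply_apply_eq_zero, map_zero, sub_zero, hr']
  have h1 : Algebra.lsmul ℂ ℂ N.carrier a =
      f' ∘ₗ (Algebra.lsmul ℂ ℂ M.carrier a ∘ₗ r') +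
        (Algebra.lsmul ℂ ℂ N.carrier a ∘ₗ q) ∘ₗ g' := by
    ext x
    change a • x = f (a • r' x) + a • q (g x)
    rw [map_smul, ← smul_add, hsplit]
  have h2 : (Algebra.lsmul ℂ ℂ M.carrier a ∘ₗ r') ∘ₗ f' = Algebra.lsmul ℂ ℂ M.carrier a := by
    ext x
    change a • r' (f x) = a • x
    rw [hr'f]
  have h3 : g' ∘ₗ (Algebra.lsmul ℂ ℂ N.carrier a ∘ₗ q) = Algebra.lsmul ℂ ℂ P.carrier a := by
    ext x
    change g (a • q x) = a • x
    rw [map_smul, hq']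
  conv_lhs => rw [h1]
  rw [map_add, LinearMap.trace_comp_comm', h2,
    LinearMap.trace_comp_comm' g' (Algebra.lsmul ℂ ℂ N.carrier a ∘ₗ q), h3]

/-- There is a homomorphism on the Grothendieck group with `[S_I^B] ↦ F_I^B` for all `I`. -/
theorem exists_chB (n : ℕ) : ∃ ch : GrothendieckGroup₀ (HeckeB n) →+ MvPowerSeries ℕ ℂ,
    ∀ I : Set (Fin n), ch (simpleModuleB I).cls = fundamentalB I := by
  classical
  let e (I : Set (Fin n)) : HeckeB n :=
    ((List.finRange n).map fun j =>
      if j ∈ I then -HeckeB.gen j else 1 + HeckeB.gen j).prod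
  have he : ∀ I K : Set (Fin n), HeckeB.simpleChar K (e I) = if I = K then 1 else 0 := by
    intro I K
    have h1 : HeckeB.simpleChar K (e I) =
        ∏ j : Fin n, (if (j ∈ I ↔ j ∈ K) then (1 : ℂ) else 0) := by
      rw [← List.prod_ofFn, List.ofFn_eq_map, map_list_prod, List.map_map]
      congr 1
      refine List.map_congr_left fun j _ => ?_
      by_cases hI : j ∈ I <;> by_cases hK : j ∈ K <;>
        simp [hI, hK, HeckeB.simpleChar_gen]
    rw [h1, Finset.prod_ite_zero]
    simp [Set.ext_iff]
  let φ : FreeAbelianGroup (FDModule (HeckeB n)) →+ MvPowerSeries ℕ ℂ :=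
    FreeAbelianGroup.lift fun M => ∑ I : Set (Fin n),
      LinearMap.trace ℂ M.carrier (Algebra.lsmul ℂ ℂ M.carrier (e I)) • fundamentalB I
  have hφ : AddSubgroup.closure (shortExactRelators (HeckeB n)) ≤ φ.ker := by
    rw [AddSubgroup.closure_le]
    rintro z ⟨M, N, P, f, g, hf, hfg, hg, rfl⟩
    change φ _ = 0
    simp only [φ, map_sub, map_add, FreeAbelianGroup.lift_apply_of]
    rw [← Finset.sum_sub_distrib, ← Finset.sum_add_distrib]
    refine Finset.sum_eq_zero fun I _ => ?_
    rw [trace_shortExact f g hf hfg hg, add_smul]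
    abel
  refine ⟨QuotientAddGroup.lift _ φ hφ, fun K => ?_⟩
  have htr : ∀ a : HeckeB n, LinearMap.trace ℂ (simpleModuleB K).carrier
      (Algebra.lsmul ℂ ℂ (simpleModuleB K).carrier a) = HeckeB.simpleChar K a := by
    intro a
    change LinearMap.trace ℂ ℂ (Algebra.lmul ℂ ℂ (HeckeB.simpleChar K a)) = _
    exact Algebra.trace_self_apply _
  change φ (FreeAbelianGroup.of _) = _
  simp only [φ, FreeAbelianGroup.lift_apply_of, htr, he]
  simp

/-- The type-B quasisymmetric characteristic `ch^B`: the homomorphism on the Grothendieck group of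
`H_n^B(0)` with `ch^B([S_I^B]) = F_I^B` for all `I`. (It is determined by this property, since every
simple module is isomorphic to some `S_I^B`.) -/
def chB (n : ℕ) : GrothendieckGroup₀ (HeckeB n) →+ MvPowerSeries ℕ ℂ :=
  Classical.choose (exists_chB n)

theorem chB_simple {n : ℕ} (I : Set (Fin n)) :
    chB n (simpleModuleB I).cls = fundamentalB I :=
  Classical.choose_spec (exists_chB n) I

end

/-!
A reflection `t` splits `B_n` into two half-spaces, according to whether `w` keeps the positive root
of `t` positive. Thus `i` is a descent of `w` exactly when `w⁻¹α_i` is negative, and the step from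
`w` to `s_i w` crosses only the wall of the reflection `w⁻¹ s_i w`.

On a coset of the dihedral group `⟨s_i, s_j⟩`, the braid relation between `π_i` and `π_j` compares
the two ascending paths from the bottom element to the top one. They cross the same walls, in
opposite orders, so ascent-compatibility of `X` makes one of them leave `X` precisely when the other
does. The resulting module `ℂX` is triangular with respect to length, so its class is a sum of
simple modules, one for each `x ∈ X`.

Writing the absolute values of the negative letters backwards and then the positive letters turns a
signed arc permutation into a cyclic interval. For `n ≤ 2` this is no restriction. For `n ≥ 3` and
`i ≥ 1`, multiplying by `s_i` exchanges the residues `i` and `i + 1`, which no cyclic interval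
survives, while an ascent by `s_0` moves the letter `1` from the positive to the negative part,
which is possible only when it sits at an end of the one-line notation. Either condition depends
only on the reflection crossed. Moreover `1` and `s_{n-1} ⋯ s_1 s_0` are then signed arc
permutations, but `s_1 s_0`, which lies between them in the left weak order, is not.
-/

noncomputable section

section HalfSpaces

variable {W ι : Type*} [Group W] {s : ι → W}

theorem exists_isReducedWord (hs : Submonoid.closure (Set.range s) = ⊤) (w : W) :
    ∃ l, IsReducedWord s l w := by
  have hw : w ∈ Submonoid.closure (Set.range s) := hs ▸ Submonoid.mem_top w
  obtain ⟨l', hl', hprod⟩ := Submonoid.exists_list_of_mem_closure hw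
  obtain ⟨l, rfl⟩ : ∃ l, List.map s l = l' := by
    rwa [← Set.mem_range, Set.range_list_map]
  obtain ⟨m, hlen, hm⟩ := Nat.sInf_mem (s := {k | ∃ l : List ι, l.length = k ∧ (l.map s).prod = w})
    ⟨_, l, rfl, hprod⟩
  exact ⟨m, hm, hlen⟩

theorem wordLength_prod_le (l : List ι) : wordLength s (l.map s).prod ≤ l.length :=
  Nat.sInf_le ⟨l, rfl, rfl⟩

variable (s) in
/-- A family of subsets `P i` of a group with generators `s i`, satisfying the axioms of Bourbaki
(*Lie groups and Lie algebras*, IV §1.7). They force `P i` to be the set of `w` that do not have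
`i` as a left descent; in a reflection group, `P i` is the set of `w` that map the fundamental
chamber to the positive side of the `i`-th wall. -/
structure IsHalfSpaceSystem (P : ι → Set W) : Prop where
  mul_self : ∀ i, s i * s i = 1
  closure_range : Submonoid.closure (Set.range s) = ⊤
  one_mem : ∀ i, 1 ∈ P i
  mul_notMem : ∀ {i w}, w ∈ P i → s i * w ∉ P i
  exchange : ∀ {i j w}, w ∈ P i → w * s j ∉ P i → s i * w = w * s j

namespace IsHalfSpaceSystem

variable {P : ι → Set W} (hP : IsHalfSpaceSystem s P) {i : ι} {w : W}

include hP

theorem mul_cancel_left (i : ι) (w : W) : s i * (s i * w) = w := by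
  rw [← mul_assoc, hP.mul_self, one_mul]

theorem exists_word_of_prod_notMem {l : List ι} (h : (l.map s).prod ∉ P i) :
    ∃ l' : List ι, l'.length + 1 = l.length ∧ (l'.map s).prod = s i * (l.map s).prod := by
  induction l using List.reverseRecOn with
  | nil => exact absurd (hP.one_mem i) h
  | append_singleton l j ih =>
    simp only [List.map_append, List.map_singleton, List.prod_append, List.prod_singleton,
      List.length_append, List.length_singleton] at h ⊢
    by_cases hl : (l.map s).prod ∈ P i
    · refine ⟨l, rfl, ?_⟩
      rw [← mul_assoc, hP.exchange hl h, mul_assoc, hP.mul_self, mul_one]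
    · obtain ⟨l', hlen, hprod⟩ := ih hl
      exact ⟨l' ++ [j], by simpa using hlen, by simp [hprod, mul_assoc]⟩

theorem wordLength_mul_lt (h : w ∉ P i) : wordLength s (s i * w) < wordLength s w := by
  obtain ⟨l, rfl, hl⟩ := exists_isReducedWord hP.closure_range w
  obtain ⟨l', hlen, hprod⟩ := hP.exists_word_of_prod_notMem h
  rw [← hprod]
  have := wordLength_prod_le (s := s) l'
  omega

theorem mem_Des_iff : i ∈ Des s w ↔ w ∉ P i := by
  refine ⟨fun h hw => ?_, hP.wordLength_mul_lt⟩
  have := hP.wordLength_mul_lt (hP.mul_notMem hw)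
  rw [hP.mul_cancel_left] at this
  exact lt_asymm h this

theorem mem_Des_mul (h : i ∉ Des s w) : i ∈ Des s (s i * w) :=
  hP.mem_Des_iff.2 (hP.mul_notMem (not_not.1 (mt hP.mem_Des_iff.2 h)))

theorem wordLength_mul (h : i ∉ Des s w) : wordLength s (s i * w) = wordLength s w + 1 := by
  refine le_antisymm ?_ ?_
  · obtain ⟨l, rfl, hl⟩ := exists_isReducedWord hP.closure_range w
    simpa [← hl] using wordLength_prod_le (s := s) (i :: l)
  · have : wordLength s (s i * (s i * w)) < wordLength s (s i * w) := hP.mem_Des_mul h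
    rwa [hP.mul_cancel_left] at this

theorem isReducedWord_cons {l : List ι} (hl : IsReducedWord s l w) (h : i ∉ Des s w) :
    IsReducedWord s (i :: l) (s i * w) :=
  ⟨by simp [hl.1], by rw [List.length_cons, hl.2, hP.wordLength_mul h]⟩

end IsHalfSpaceSystem

end HalfSpaces

section AlternatingProducts

open CoxeterSystem (alternatingWord)

variable {ι : Type*}

/-- The product `⋯ f i * f j * f i * f j` of `k` alternating factors, the last of which is `f j`. -/
def alternatingProd {M : Type*} [Monoid M] (f : ι → M) (i j : ι) (k : ℕ) : M :=
  ((alternatingWord i j k).map f).prod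

/-- The index of the factor by which `alternatingProd f i j k` has to be multiplied on the left to
obtain `alternatingProd f i j (k + 1)`. -/
def nextLetter (i j : ι) (k : ℕ) : ι := if Even k then j else i

theorem nextLetter_eq_or (i j : ι) (k : ℕ) : nextLetter i j k = i ∨ nextLetter i j k = j := by
  unfold nextLetter
  split_ifs <;> simp

theorem nextLetter_succ (i j : ι) (k : ℕ) : nextLetter i j (k + 1) = nextLetter j i k := by
  simp only [nextLetter, Nat.even_add_one, ite_not]

section Monoid

variable {M : Type*} [Monoid M] (f : ι → M) (i j : ι) (k : ℕ)

theorem alternatingProd_zero : alternatingProd f i j 0 = 1 := rfl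

theorem alternatingProd_succ :
    alternatingProd f i j (k + 1) = alternatingProd f j i k * f j := by
  simp [alternatingProd, CoxeterSystem.alternatingWord_succ]

theorem alternatingProd_succ' :
    alternatingProd f i j (k + 1) = f (nextLetter i j k) * alternatingProd f i j k := by
  simp [alternatingProd, CoxeterSystem.alternatingWord_succ', nextLetter]

end Monoid

section Involutions

variable {W : Type*} [Group W] {s : ι → W} (hs : ∀ i, s i * s i = 1)

include hs

theorem alternatingProd_conj_nextLetter (i j : ι) (k : ℕ) :
    (alternatingProd s i j k)⁻¹ * s (nextLetter i j k) * alternatingProd s i j k =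
      (s j * s i) ^ k * s j := by
  induction k generalizing i j with
  | zero => simp [alternatingProd_zero, nextLetter]
  | succ k ih =>
    calc (alternatingProd s i j (k + 1))⁻¹ * s (nextLetter i j (k + 1)) *
          alternatingProd s i j (k + 1)
        = (s j)⁻¹ * ((alternatingProd s j i k)⁻¹ * s (nextLetter j i k) *
            alternatingProd s j i k) * s j := by
          simp only [alternatingProd_succ, nextLetter_succ, mul_inv_rev, mul_assoc]
      _ = s j * ((s i * s j) ^ k * s i) * s j := by rw [ih, inv_eq_of_mul_eq_one_left (hs j)]
      _ = (s j * s i) ^ (k + 1) * s j := by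
          rw [← mul_assoc, ← mul_pow_mul, mul_assoc (_ ^ k), ← pow_succ]

theorem alternatingProd_inv_mul_swap (i j : ι) (k : ℕ) :
    (alternatingProd s j i k)⁻¹ * alternatingProd s i j k = (s i * s j) ^ k := by
  induction k generalizing i j with
  | zero => simp [alternatingProd_zero]
  | succ k ih =>
    calc (alternatingProd s j i (k + 1))⁻¹ * alternatingProd s i j (k + 1)
        = (s i)⁻¹ * ((alternatingProd s i j k)⁻¹ * alternatingProd s j i k) * s j := by
          simp only [alternatingProd_succ, mul_inv_rev, mul_assoc]
      _ = s i * (s j * s i) ^ k * s j := by rw [ih, inv_eq_of_mul_eq_one_left (hs i)]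
      _ = (s i * s j) ^ (k + 1) := by rw [← mul_pow_mul, mul_assoc, ← pow_succ]

theorem pow_mul_eq_of_pow_eq_one {i j : ι} {k l : ℕ} (h : (s i * s j) ^ (k + l + 1) = 1) :
    (s i * s j) ^ k * s i = (s j * s i) ^ l * s j := by
  have hinv : s j * s i = (s i * s j)⁻¹ := by
    rw [mul_inv_rev, inv_eq_of_mul_eq_one_left (hs i), inv_eq_of_mul_eq_one_left (hs j)]
  rw [← mul_left_inj (s j), mul_assoc, ← pow_succ, mul_assoc, hs, mul_one, hinv, inv_pow,
    eq_inv_iff_mul_eq_one, ← pow_add]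
  convert h using 2
  omega

end Involutions

end AlternatingProducts

section BasisVec

variable {W : Type*} {X : Set W} {w : W}

open Classical in
variable (X) in
/-- The basis vector `w` of `ℂX` if `w ∈ X`, and `0` otherwise. -/
def basisVec (w : W) : X →₀ ℂ := if h : w ∈ X then Finsupp.single ⟨w, h⟩ 1 else 0

theorem basisVec_coe (x : X) : basisVec X (x : W) = Finsupp.single x 1 := dif_pos x.2

theorem basisVec_of_notMem (h : w ∉ X) : basisVec X w = 0 := dif_neg h

theorem end_ext_basisVec {f g : Module.End ℂ (X →₀ ℂ)}
    (h : ∀ w, f (basisVec X w) = g (basisVec X w)) : f = g := by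
  refine Finsupp.lhom_ext' fun x => LinearMap.ext_ring ?_
  simpa only [basisVec_coe] using! h x

end BasisVec

section BraidRelations

variable {W ι : Type*} [Group W] {s : ι → W} {X : Set W} {i j : ι} {w : W}

theorem piOp_basisVec_of_mem_Des (h : i ∈ Des s w) :
    piOp s X i (basisVec X w) = -basisVec X w := by
  by_cases hw : w ∈ X
  · simp [basisVec, hw, piOp, h]
  · simp [basisVec_of_notMem hw]

theorem piOp_basisVec_of_notMem_Des (hw : w ∈ X) (h : i ∉ Des s w) :
    piOp s X i (basisVec X w) = basisVec X (s i * w) := by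
  simp [basisVec, hw, piOp, h]

variable (s) in
/-- `ClimbsToTop s i j r w`: multiplying `w` on the left by `r` alternating letters `s j, s i, …`
(starting with `s j`) goes up at every step, and ends at an element that has both `i` and `j` as
descents. -/
def ClimbsToTop : ι → ι → ℕ → W → Prop
  | i, j, 0, w => i ∈ Des s w ∧ j ∈ Des s w
  | i, j, r + 1, w => j ∉ Des s w ∧ ClimbsToTop j i r (s j * w)

theorem ClimbsToTop.nextLetter_notMem_Des {r k : ℕ} (h : ClimbsToTop s i j r w) (hk : k < r) :
    nextLetter i j k ∉ Des s (alternatingProd s i j k * w) := by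
  induction k generalizing i j w r with
  | zero =>
    obtain _ | r := r
    · exact absurd hk (Nat.not_lt_zero _)
    · simpa [nextLetter, alternatingProd_zero] using h.1
  | succ k ih =>
    obtain _ | r := r
    · exact absurd hk (Nat.not_lt_zero _)
    · simpa only [nextLetter_succ, alternatingProd_succ, mul_assoc] using
        ih h.2 (Nat.lt_of_succ_lt_succ hk)

theorem ClimbsToTop.mem_Des_alternatingProd {r : ℕ} (h : ClimbsToTop s i j r w) :
    i ∈ Des s (alternatingProd s i j r * w) ∧ j ∈ Des s (alternatingProd s i j r * w) := by
  induction r generalizing i j w with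
  | zero => simpa only [alternatingProd_zero, one_mul, ClimbsToTop] using h
  | succ r ih => simpa only [alternatingProd_succ, mul_assoc] using (ih h.2).symm

theorem ClimbsToTop.piOp_alternatingProd {r k : ℕ} (h : ClimbsToTop s i j r w) (hk : r ≤ k) :
    let v := alternatingProd (piOp s X) i j k (basisVec X w)
    piOp s X i v = -v ∧ piOp s X j v = -v := by
  induction k generalizing i j w r with
  | zero =>
    obtain rfl : r = 0 := Nat.le_zero.1 hk
    exact ⟨piOp_basisVec_of_mem_Des h.1, piOp_basisVec_of_mem_Des h.2⟩
  | succ k ih =>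
    simp only [alternatingProd_succ, Module.End.mul_apply]
    obtain _ | r := r
    · have htop : ClimbsToTop s j i 0 w := h.symm
      simpa only [piOp_basisVec_of_mem_Des h.2, map_neg, neg_inj] using (ih htop k.zero_le).symm
    · by_cases hw : w ∈ X
      · rw [piOp_basisVec_of_notMem_Des hw h.1]
        exact (ih h.2 (Nat.le_of_succ_le_succ hk)).symm
      · simp [basisVec_of_notMem hw]

theorem ClimbsToTop.alternatingProd_piOp_swap {r k : ℕ} (h : ClimbsToTop s i j r w) (hk : r ≤ k)
    (hi : i ∈ Des s w) :
    alternatingProd (piOp s X) i j (k + 1) (basisVec X w) =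
      alternatingProd (piOp s X) j i (k + 1) (basisVec X w) := by
  have hnext : piOp s X (nextLetter i j k) (alternatingProd (piOp s X) i j k (basisVec X w)) =
      -alternatingProd (piOp s X) i j k (basisVec X w) := by
    have htop := h.piOp_alternatingProd (X := X) hk
    rcases nextLetter_eq_or i j k with hc | hc <;> rw [hc]
    exacts [htop.1, htop.2]
  rw [alternatingProd_succ', Module.End.mul_apply, hnext, alternatingProd_succ,
    Module.End.mul_apply, piOp_basisVec_of_mem_Des hi, map_neg]

variable (X) in
open Classical in
theorem ClimbsToTop.alternatingProd_piOp_apply {r k : ℕ} (h : ClimbsToTop s i j r w) (hk : k ≤ r) :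
    alternatingProd (piOp s X) i j k (basisVec X w) =
      if ∀ l ≤ k, alternatingProd s i j l * w ∈ X then
        basisVec X (alternatingProd s i j k * w) else 0 := by
  induction k with
  | zero =>
    by_cases hw : w ∈ X <;> simp [alternatingProd_zero, hw, basisVec_of_notMem]
  | succ k ih =>
    rw [alternatingProd_succ', Module.End.mul_apply, ih (Nat.le_of_succ_le hk)]
    by_cases hpath : ∀ l ≤ k, alternatingProd s i j l * w ∈ X
    · rw [if_pos hpath, piOp_basisVec_of_notMem_Des (hpath k le_rfl) (h.nextLetter_notMem_Des hk),
        ← mul_assoc, ← alternatingProd_succ']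
      split_ifs with hpath'
      · rfl
      · refine basisVec_of_notMem fun hmem => hpath' fun l hl => ?_
        obtain hl | rfl := hl.lt_or_eq
        exacts [hpath l (Nat.le_of_lt_succ hl), hmem]
    · rw [if_neg hpath, map_zero, if_neg fun hpath' => hpath fun l hl => hpath' l (by omega)]

variable (s) in
/-- On each coset of the subgroup generated by `s i` and `s j`, the left weak order is that of the
dihedral group of order `2 * m`. -/
structure IsDihedralPair (m : ℕ) (i j : ι) : Prop where
  climbsToTop : ∀ {w}, i ∉ Des s w → j ∉ Des s w →
    ClimbsToTop s i j m w ∧ ClimbsToTop s j i m w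
  climbsToTop_left : ∀ {w}, i ∈ Des s w → ∃ r < m, ClimbsToTop s i j r w
  climbsToTop_right : ∀ {w}, j ∈ Des s w → ∃ r < m, ClimbsToTop s j i r w

namespace IsDihedralPair

variable {m : ℕ}

theorem symm (h : IsDihedralPair s m i j) : IsDihedralPair s m j i where
  climbsToTop hj hi := (h.climbsToTop hi hj).symm
  climbsToTop_left := h.climbsToTop_right
  climbsToTop_right := h.climbsToTop_left

theorem alternatingProd_swap {P : ι → Set W} (h : IsDihedralPair s m i j)
    (hP : IsHalfSpaceSystem s P) : alternatingProd s i j m = alternatingProd s j i m := by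
  have hone (i : ι) : i ∉ Des s 1 := by simpa only [hP.mem_Des_iff, not_not] using hP.one_mem i
  obtain ⟨hclimb, hclimb'⟩ := h.climbsToTop (hone i) (hone j)
  obtain _ | k := m
  · rfl
  have hbelow : alternatingProd s i j k ∈ P (nextLetter i j k) := by
    simpa only [hP.mem_Des_iff, not_not, mul_one] using hclimb.nextLetter_notMem_Des k.lt_succ_self
  have htop : alternatingProd s i j k * s i ∉ P (nextLetter i j k) := by
    rw [← hP.mem_Des_iff, ← alternatingProd_succ, ← mul_one (alternatingProd _ _ _ _)]
    rcases nextLetter_eq_or i j k with hc | hc <;> rw [hc]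
    exacts [hclimb'.mem_Des_alternatingProd.2, hclimb'.mem_Des_alternatingProd.1]
  rw [alternatingProd_succ', hP.exchange hbelow htop, ← alternatingProd_succ]

theorem pow_eq_one {P : ι → Set W} (h : IsDihedralPair s m i j) (hP : IsHalfSpaceSystem s P) :
    (s i * s j) ^ m = 1 := by
  rw [← alternatingProd_inv_mul_swap hP.mul_self, inv_mul_eq_one, h.alternatingProd_swap hP]

-- The two monotone paths from `w` to the top of its coset carry the same reflections in opposite
-- orders, so ascent-compatibility lets one path leave `X` only where the other one does.
theorem path_mem_of_path_mem (hs : ∀ i, s i * s i = 1) (hX : AscentCompatible s X)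
    (hij : (s i * s j) ^ m = 1) (hi : ClimbsToTop s i j m w) (hj : ClimbsToTop s j i m w)
    (hpath : ∀ l ≤ m, alternatingProd s i j l * w ∈ X) {l : ℕ} (hl : l ≤ m) :
    alternatingProd s j i l * w ∈ X := by
  induction l with
  | zero => simpa [alternatingProd_zero] using hpath 0 m.zero_le
  | succ l ih =>
    obtain ⟨k, rfl⟩ : ∃ k, m = l + k + 1 := ⟨m - l - 1, by omega⟩
    have hu := hpath k (by omega)
    have hv := ih (by omega)
    have haligned : Aligned s (alternatingProd s j i l * w) (alternatingProd s i j k * w)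
        (nextLetter j i l) (nextLetter i j k) := by
      refine ⟨hj.nextLetter_notMem_Des (by omega), hi.nextLetter_notMem_Des (by omega), ?_⟩
      calc (alternatingProd s j i l * w)⁻¹ * s (nextLetter j i l) * (alternatingProd s j i l * w)
          = w⁻¹ * ((alternatingProd s j i l)⁻¹ * s (nextLetter j i l) *
              alternatingProd s j i l) * w := by simp only [mul_inv_rev, mul_assoc]
        _ = w⁻¹ * ((alternatingProd s i j k)⁻¹ * s (nextLetter i j k) *
              alternatingProd s i j k) * w := by
            rw [alternatingProd_conj_nextLetter hs, alternatingProd_conj_nextLetter hs,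
              pow_mul_eq_of_pow_eq_one hs hij]
        _ = _ := by simp only [mul_inv_rev, mul_assoc]
    have hnext : alternatingProd s i j (k + 1) * w ∈ X := hpath (k + 1) (by omega)
    rw [alternatingProd_succ', mul_assoc] at hnext ⊢
    exact (hX _ hv _ hu _ _ haligned).2 hnext

theorem path_mem_iff {P : ι → Set W} (h : IsDihedralPair s m i j) (hP : IsHalfSpaceSystem s P)
    (hX : AscentCompatible s X) (hi : i ∉ Des s w) (hj : j ∉ Des s w) :
    (∀ l ≤ m, alternatingProd s i j l * w ∈ X) ↔ ∀ l ≤ m, alternatingProd s j i l * w ∈ X := by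
  obtain ⟨hclimb, hclimb'⟩ := h.climbsToTop hi hj
  exact ⟨fun hpath _ =>
      path_mem_of_path_mem hP.mul_self hX (h.pow_eq_one hP) hclimb hclimb' hpath,
    fun hpath _ =>
      path_mem_of_path_mem hP.mul_self hX (h.symm.pow_eq_one hP) hclimb' hclimb hpath⟩

theorem alternatingProd_piOp_swap {P : ι → Set W} (h : IsDihedralPair s m i j)
    (hP : IsHalfSpaceSystem s P) (hX : AscentCompatible s X) :
    alternatingProd (piOp s X) i j m = alternatingProd (piOp s X) j i m := by
  refine end_ext_basisVec fun w => ?_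
  by_cases hi : i ∈ Des s w
  · obtain ⟨r, hr, hclimb⟩ := h.climbsToTop_left hi
    obtain ⟨k, rfl⟩ := Nat.exists_eq_add_one_of_ne_zero (Nat.ne_zero_of_lt hr)
    exact hclimb.alternatingProd_piOp_swap (Nat.le_of_lt_succ hr) hi
  by_cases hj : j ∈ Des s w
  · obtain ⟨r, hr, hclimb⟩ := h.climbsToTop_right hj
    obtain ⟨k, rfl⟩ := Nat.exists_eq_add_one_of_ne_zero (Nat.ne_zero_of_lt hr)
    exact (hclimb.alternatingProd_piOp_swap (Nat.le_of_lt_succ hr) hj).symm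
  obtain ⟨hclimb, hclimb'⟩ := h.climbsToTop hi hj
  classical
  rw [hclimb.alternatingProd_piOp_apply X le_rfl, hclimb'.alternatingProd_piOp_apply X le_rfl,
    h.alternatingProd_swap hP]
  simp only [h.path_mem_iff hP hX hi hj]

end IsDihedralPair

theorem IsHalfSpaceSystem.piOp_mul_self {P : ι → Set W} (hP : IsHalfSpaceSystem s P) :
    piOp s X i * piOp s X i = -piOp s X i := by
  refine end_ext_basisVec fun w => ?_
  rw [Module.End.mul_apply, LinearMap.neg_apply]
  by_cases hi : i ∈ Des s w
  · rw [piOp_basisVec_of_mem_Des hi, map_neg, piOp_basisVec_of_mem_Des hi]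
  by_cases hw : w ∈ X
  · rw [piOp_basisVec_of_notMem_Des hw hi, piOp_basisVec_of_mem_Des (hP.mem_Des_mul hi)]
  · simp [basisVec_of_notMem hw]

end BraidRelations

namespace FDModule

variable {A : Type} [Ring A] [Algebra ℂ A]

/-- The one-dimensional module on which `A` acts through the character `χ`. -/
def ofCharacter (χ : A →ₐ[ℂ] ℂ) : FDModule A := ofRep ((Algebra.lmul ℂ ℂ).comp χ)

/-- A submodule of a finite-dimensional module, as a module in its own right. -/
def ofSubmodule (M : FDModule A) (N : Submodule A M.carrier) : FDModule A :=
  haveI : Module.Finite ℂ N := inferInstanceAs (Module.Finite ℂ (N.restrictScalars ℂ))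
  { carrier := N }

theorem cls_eq_add {M N P : FDModule A} {f : M.carrier →ₗ[A] N.carrier}
    {g : N.carrier →ₗ[A] P.carrier} (hf : Function.Injective f) (hfg : Function.Exact f g)
    (hg : Function.Surjective g) : N.cls = M.cls + P.cls := by
  have hrel : M.cls - N.cls + P.cls = 0 :=
    (QuotientAddGroup.eq_zero_iff _).2
      (AddSubgroup.subset_closure ⟨M, N, P, f, g, hf, hfg, hg, rfl⟩)
  rw [sub_add_eq_add_sub, sub_eq_zero] at hrel
  exact hrel.symm

theorem cls_eq_zero (M : FDModule A) [Subsingleton M.carrier] : M.cls = 0 := by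
  have hself : M.cls = M.cls + M.cls :=
    cls_eq_add (f := LinearMap.id) (g := LinearMap.id) Function.injective_id
      (fun v => ⟨fun _ => ⟨v, rfl⟩, fun _ => Subsingleton.elim _ _⟩) Function.surjective_id
  simpa using hself

theorem cls_ofSubmodule_top (M : FDModule A) : (M.ofSubmodule ⊤).cls = M.cls := by
  have : Subsingleton (M.ofSubmodule ⊥).carrier :=
    inferInstanceAs (Subsingleton (⊥ : Submodule A _))
  have hexact : Function.Exact (Submodule.inclusion bot_le) (⊤ : Submodule A M.carrier).subtype :=
    fun v => ⟨fun hv => ⟨0, Subtype.ext hv.symm⟩, by rintro ⟨⟨_, rfl⟩, rfl⟩; rfl⟩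
  rw [cls_eq_add (M := M.ofSubmodule ⊥) (N := M.ofSubmodule ⊤) (Submodule.inclusion_injective _)
    hexact fun v => ⟨⟨v, trivial⟩, rfl⟩, cls_eq_zero, zero_add]

theorem cls_ofSubmodule_eq_add {M : FDModule A} {N K : Submodule A M.carrier} {χ : A →ₐ[ℂ] ℂ}
    {φ : Module.Dual ℂ M.carrier} (hφ : ∀ a, ∀ v ∈ N, φ (a • v) = χ a * φ v)
    (hK : ∀ v, v ∈ K ↔ v ∈ N ∧ φ v = 0) {u : M.carrier} (hu : u ∈ N) (hu1 : φ u = 1) :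
    (M.ofSubmodule N).cls = (M.ofSubmodule K).cls + (ofCharacter χ).cls := by
  have hKN : K ≤ N := fun v hv => ((hK v).1 hv).1
  let g : N →ₗ[A] (ofCharacter χ).carrier :=
    { toFun v := φ (v : M.carrier)
      map_add' v w := map_add φ (v : M.carrier) w
      map_smul' a v := hφ a v v.2 }
  refine cls_eq_add (M := M.ofSubmodule K) (N := M.ofSubmodule N) (f := Submodule.inclusion hKN)
    (g := g) (Submodule.inclusion_injective hKN) ?_ fun c => ?_
  · rintro (v : N)
    constructor
    · exact fun hv => ⟨⟨v, (hK v).2 ⟨v.2, hv⟩⟩, rfl⟩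
    · rintro ⟨⟨v, hv⟩, rfl⟩
      exact ((hK v).1 hv).2
  · let z : ℂ := c
    refine ⟨⟨z • u, N.smul_of_tower_mem z hu⟩, ?_⟩
    change φ (z • u) = z
    rw [map_smul, hu1, smul_eq_mul, mul_one]

theorem apply_smul_of_adjoin_eq_top {S : Set A} (hS : Algebra.adjoin ℂ S = ⊤) {M : FDModule A}
    {N : Submodule A M.carrier} {χ : A →ₐ[ℂ] ℂ} {φ : Module.Dual ℂ M.carrier}
    (hφ : ∀ a ∈ S, ∀ v ∈ N, φ (a • v) = χ a * φ v) (a : A) :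
    ∀ v ∈ N, φ (a • v) = χ a * φ v := by
  have ha : a ∈ Algebra.adjoin ℂ S := hS ▸ Algebra.mem_top
  induction ha using Algebra.adjoin_induction with
  | mem a ha => exact hφ a ha
  | algebraMap c => simp
  | add a b _ _ ha hb => intro v hv; rw [add_smul, map_add, ha v hv, hb v hv, map_add, add_mul]
  | mul a b _ _ ha hb =>
    intro v hv
    rw [mul_smul, ha _ (N.smul_mem b hv), hb v hv, map_mul, mul_assoc]

section Triangular

variable {X α : Type*} [LinearOrder α] {S : Set A} {M : FDModule A}
  {b : Module.Basis X ℂ M.carrier} {len : X → α} {χ : X → A →ₐ[ℂ] ℂ}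

theorem coord_smul_of_triangular {a : A}
    (ha : ∀ x y, len x ≤ len y → b.coord x (a • b y) = χ x a * b.coord x (b y)) {x : X} {T : Set X}
    (hT : ∀ y ∈ T, len x ≤ len y) {v : M.carrier} (hv : v ∈ Submodule.span ℂ (b '' T)) :
    b.coord x (a • v) = χ x a * b.coord x v := by
  refine LinearMap.eqOn_span (f := b.coord x ∘ₗ Algebra.lsmul ℂ ℂ M.carrier a)
    (g := χ x a • b.coord x) ?_ hv
  rintro _ ⟨y, hy, rfl⟩
  exact ha x y (hT y hy)

theorem mem_span_image_iff_of_insert {x : X} {T : Set X} (hx : x ∉ T) (v : M.carrier) :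
    v ∈ Submodule.span ℂ (b '' T) ↔
      v ∈ Submodule.span ℂ (b '' insert x T) ∧ b.coord x v = 0 := by
  rw [b.mem_span_image, b.mem_span_image, b.coord_apply, ← Finsupp.notMem_support_iff]
  exact ⟨fun h => ⟨h.trans (Set.subset_insert x T), fun hmem => hx (h hmem)⟩,
    fun h => (Set.subset_insert_iff_of_notMem h.2).1 h.1⟩

theorem cls_eq_sum_of_triangular [Fintype X] (hS : Algebra.adjoin ℂ S = ⊤)
    (htri : ∀ a ∈ S, ∀ x y, len x ≤ len y → b.coord x (a • b y) = χ x a * b.coord x (b y)) :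
    M.cls = ∑ x, (ofCharacter (χ x)).cls := by
  classical
  suffices H : ∀ (T : Finset X) (N : Submodule A M.carrier),
      N.restrictScalars ℂ = Submodule.span ℂ (b '' T) →
      (M.ofSubmodule N).cls = ∑ x ∈ T, (ofCharacter (χ x)).cls by
    rw [← cls_ofSubmodule_top]
    exact H Finset.univ ⊤ (by simp [b.span_eq])
  intro T
  induction T using Finset.induction_on_min_value len with
  | empty =>
    intro N hN
    have : Subsingleton (M.ofSubmodule N).carrier := by
      obtain rfl : N = ⊥ := by simpa using hN
      exact inferInstanceAs (Subsingleton (⊥ : Submodule A _))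
    rw [cls_eq_zero, Finset.sum_empty]
  | insert x T hx hmin ih =>
    intro N hN
    have hmemN : ∀ v, v ∈ N ↔ v ∈ Submodule.span ℂ (b '' insert x T) := fun v => by
      rw [← Finset.coe_insert, ← hN, Submodule.restrictScalars_mem]
    have hcoord : ∀ a, ∀ v ∈ N, b.coord x (a • v) = χ x a * b.coord x v :=
      apply_smul_of_adjoin_eq_top hS fun a ha v hv =>
        coord_smul_of_triangular (htri a ha) (by simpa using hmin) ((hmemN v).1 hv)
    let K : Submodule A M.carrier :=
      { carrier := {v | v ∈ N ∧ b.coord x v = 0}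
        add_mem' := fun hv hw => ⟨N.add_mem hv.1 hw.1, by rw [map_add, hv.2, hw.2, add_zero]⟩
        zero_mem' := ⟨N.zero_mem, map_zero _⟩
        smul_mem' := fun a v hv => ⟨N.smul_mem a hv.1, by rw [hcoord a v hv.1, hv.2, mul_zero]⟩ }
    have hK : K.restrictScalars ℂ = Submodule.span ℂ (b '' T) := by
      ext v
      rw [mem_span_image_iff_of_insert (Finset.mem_coe.not.2 hx), ← hmemN]
      rfl
    rw [Finset.sum_insert hx, add_comm, ← ih K hK]
    exact cls_ofSubmodule_eq_add hcoord (fun _ => Iff.rfl)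
      ((hmemN _).2 (Submodule.subset_span ⟨x, Set.mem_insert x T, rfl⟩)) (by simp)

end Triangular

end FDModule

namespace PM

variable {n : ℕ}

theorem bounds (k : PM n) : -(n : ℤ) ≤ k ∧ (k : ℤ) ≤ n ∧ (k : ℤ) ≠ 0 := by
  have := k.2
  simp only [Finset.mem_erase, Finset.mem_Icc] at this
  tauto

theorem coe_pos (j : Fin n) : ((pos j : PM n) : ℤ) = j + 1 := rfl

theorem strictMono_pos : StrictMono (pos : Fin n → PM n) := fun i j hij => by
  rw [← Subtype.coe_lt_coe, coe_pos, coe_pos]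
  omega

theorem exists_pos_eq {k : PM n} (hk : 0 < (k : ℤ)) : ∃ j, pos j = k := by
  have := k.bounds
  exact ⟨⟨(k : ℤ).toNat - 1, by omega⟩, Subtype.ext (by simp only [coe_pos]; omega)⟩

theorem eq_pos_or_eq_neg_pos (k : PM n) : ∃ j : Fin n, k = pos j ∨ k = -pos j := by
  rcases lt_or_gt_of_ne k.bounds.2.2 with hk | hk
  · obtain ⟨j, hj⟩ := exists_pos_eq (k := -k) (by rw [coe_neg]; omega)
    exact ⟨j, Or.inr (by rw [hj, neg_neg])⟩
  · obtain ⟨j, hj⟩ := exists_pos_eq hk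
    exact ⟨j, Or.inl hj.symm⟩

end PM

/-- The action of the simple generator `s_i` on integers. -/
def simpleVal (i : ℕ) (x : ℤ) : ℤ :=
  if i = 0 then if x = 1 then -1 else if x = -1 then 1 else x
  else if x = i then i + 1 else if x = i + 1 then i
  else if x = -i then -(i + 1) else if x = -(i + 1) then -i else x

section SimplePerm

variable {n : ℕ} {i j : Fin n}

theorem coe_simplePerm (i : Fin n) (k : PM n) : (simplePerm i k : ℤ) = simpleVal i k := by
  have := i.2
  unfold simplePerm simpleVal
  split_ifs with h <;>
  simp only [Equiv.Perm.mul_apply, Equiv.swap_apply_def, Subtype.ext_iff, PM.coe_neg, PM.coe_pos,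
    apply_ite Subtype.val] <;>
  split_ifs <;> omega

theorem simplePerm_simplePerm (i : Fin n) (k : PM n) : simplePerm i (simplePerm i k) = k := by
  apply Subtype.ext
  rw [coe_simplePerm, coe_simplePerm]
  grind [simpleVal]

theorem simplePerm_pos_zero (hi : (i : ℕ) = 0) : simplePerm i (PM.pos i) = -PM.pos i := by
  apply Subtype.ext
  simp [coe_simplePerm, PM.coe_pos, PM.coe_neg, simpleVal, hi]

theorem simplePerm_pos_succ (h : (j : ℕ) = i + 1) : simplePerm j (PM.pos j) = PM.pos i := by
  apply Subtype.ext
  simp [coe_simplePerm, PM.coe_pos, simpleVal, h]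

theorem simplePerm_pos_pred (h : (j : ℕ) = i + 1) : simplePerm j (PM.pos i) = PM.pos j := by
  rw [← simplePerm_pos_succ h, simplePerm_simplePerm]

theorem simplePerm_pos_of_ne (h : (j : ℕ) ≠ i) (h' : (j : ℕ) ≠ i + 1) :
    simplePerm j (PM.pos i) = PM.pos i := by
  apply Subtype.ext
  rw [coe_simplePerm, PM.coe_pos]
  unfold simpleVal
  split_ifs <;> omega

theorem simplePerm_pos_lt (i : Fin n) : simplePerm i (PM.pos i) < PM.pos i := by
  rw [← Subtype.coe_lt_coe, coe_simplePerm, PM.coe_pos]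
  unfold simpleVal
  split_ifs <;> omega

theorem simplePerm_eq_self {k : PM n} (h₁ : k ≠ PM.pos i) (h₂ : k ≠ -PM.pos i)
    (h₃ : k ≠ simplePerm i (PM.pos i)) (h₄ : k ≠ -simplePerm i (PM.pos i)) :
    simplePerm i k = k := by
  have := i.2
  simp only [ne_eq, Subtype.ext_iff, coe_simplePerm, PM.coe_neg, PM.coe_pos] at *
  simp only [simpleVal] at *
  split_ifs at * <;> omega

-- `α_i` is the only positive root that `s_i` makes negative.
theorem eq_or_eq_of_simplePerm_not_lt {x y : PM n} (hxy : x < y)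
    (h : ¬simplePerm i x < simplePerm i y) :
    x = simplePerm i (PM.pos i) ∧ y = PM.pos i ∨
      x = -PM.pos i ∧ y = -simplePerm i (PM.pos i) := by
  have hx := x.bounds
  have hy := y.bounds
  rw [← Subtype.coe_lt_coe] at hxy h
  simp only [Subtype.ext_iff, PM.coe_neg, coe_simplePerm, PM.coe_pos] at *
  simp only [simpleVal] at *
  split_ifs at * <;> omega

theorem simpleB_mul_self (i : Fin n) : simpleB n i * simpleB n i = 1 :=
  Subtype.ext (Equiv.ext fun k => simplePerm_simplePerm i k)

end SimplePerm

section HalfSpacesB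

variable {n : ℕ} {i j : Fin n} {w : hyperoctahedralGroup n}

theorem inv_apply_neg (w : hyperoctahedralGroup n) (k : PM n) :
    w.1⁻¹ (-k) = -w.1⁻¹ k := (w⁻¹).2 k

theorem simpleB_mul_inv_apply (i : Fin n) (w : hyperoctahedralGroup n) (k : PM n) :
    (simpleB n i * w).1⁻¹ k = w.1⁻¹ (simplePerm i k) := by
  rw [Equiv.Perm.inv_eq_iff_eq]
  change k = simplePerm i (w.1 (w.1.symm (simplePerm i k)))
  rw [Equiv.apply_symm_apply, simplePerm_simplePerm]

theorem mul_simpleB_inv_apply (i : Fin n) (w : hyperoctahedralGroup n) (k : PM n) :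
    (w * simpleB n i).1⁻¹ k = simplePerm i (w.1⁻¹ k) := by
  rw [Equiv.Perm.inv_eq_iff_eq]
  change k = w.1 (simplePerm i (simplePerm i (w.1.symm k)))
  rw [simplePerm_simplePerm, Equiv.apply_symm_apply]

/-- The value of `w⁻¹` on the `i`-th simple root, where `α_0 = 2 e_1` and `α_i = e_{i+1} - e_i`,
with `w⁻¹` extended to a linear form by `e_k ↦ w⁻¹(k)`. Its sign is that of the root `w⁻¹ α_i`. -/
def rootValue (w : hyperoctahedralGroup n) (i : Fin n) : ℤ :=
  w.1⁻¹ (PM.pos i) - w.1⁻¹ (simplePerm i (PM.pos i))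

theorem rootValue_pos_iff :
    0 < rootValue w i ↔ w.1⁻¹ (simplePerm i (PM.pos i)) < w.1⁻¹ (PM.pos i) := by
  rw [rootValue, sub_pos, Subtype.coe_lt_coe]

theorem rootValue_simpleB_mul_self (w : hyperoctahedralGroup n) (i : Fin n) :
    rootValue (simpleB n i * w) i = -rootValue w i := by
  simp only [rootValue, simpleB_mul_inv_apply, simplePerm_simplePerm, neg_sub]

theorem simplePerm_apply_eq_apply_simplePerm {σ : Equiv.Perm (PM n)} (hσ : ∀ k, σ (-k) = -σ k)
    {x : PM n} (hfix : ∀ k, k ≠ x → k ≠ -x → k ≠ simplePerm j x → k ≠ -simplePerm j x →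
      simplePerm j k = k)
    (hx : σ x = PM.pos i) (hx' : σ (simplePerm j x) = simplePerm i (PM.pos i)) (k : PM n) :
    simplePerm i (σ k) = σ (simplePerm j k) := by
  by_cases h₁ : k = x
  · rw [h₁, hx, hx']
  by_cases h₂ : k = -x
  · rw [h₂, simplePerm_neg, hσ, hσ, hx, hx', simplePerm_neg]
  by_cases h₃ : k = simplePerm j x
  · rw [h₃, hx', simplePerm_simplePerm, simplePerm_simplePerm, hx]
  by_cases h₄ : k = -simplePerm j x
  · rw [h₄, hσ, hx', simplePerm_neg, simplePerm_neg, hσ, simplePerm_simplePerm,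
      simplePerm_simplePerm, hx]
  rw [hfix k h₁ h₂ h₃ h₄]
  have hne {y : PM n} : k ≠ y → σ k ≠ σ y := σ.injective.ne
  exact simplePerm_eq_self (hx ▸ hne h₁) (by rw [← hx, ← hσ]; exact hne h₂) (hx' ▸ hne h₃)
    (by rw [← hx', ← hσ]; exact hne h₄)

theorem simpleB_exchange (hw : 0 < rootValue w i) (hwj : ¬0 < rootValue (w * simpleB n j) i) :
    simpleB n i * w = w * simpleB n j := by
  rw [rootValue_pos_iff] at hw hwj
  simp only [mul_simpleB_inv_apply] at hwj
  refine Subtype.ext (Equiv.ext fun k => ?_)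
  rcases eq_or_eq_of_simplePerm_not_lt hw hwj with ⟨hneg, hpos⟩ | ⟨hneg, hpos⟩ <;>
    rw [Equiv.Perm.inv_eq_iff_eq] at hneg hpos
  · exact simplePerm_apply_eq_apply_simplePerm w.2 (fun _ => simplePerm_eq_self) hpos.symm
      hneg.symm k
  · refine simplePerm_apply_eq_apply_simplePerm w.2 (x := -simplePerm j (PM.pos j)) (fun k => ?_)
      hpos.symm ?_ k
    · simp only [simplePerm_neg, simplePerm_simplePerm, PM.neg_neg]
      exact fun h₁ h₂ h₃ h₄ => simplePerm_eq_self h₄ h₃ h₂ h₁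
    · rw [simplePerm_neg, simplePerm_simplePerm, hneg]

theorem strictMono_inv_apply_pos (hw : ∀ i, 0 < rootValue w i) :
    StrictMono fun j => w.1⁻¹ (PM.pos j) := by
  obtain _ | n := n
  · exact Subsingleton.strictMono _
  refine Fin.strictMono_iff_lt_succ.2 fun i => ?_
  rw [← simplePerm_pos_succ (j := i.succ) (i := i.castSucc) (by simp)]
  exact rootValue_pos_iff.1 (hw i.succ)

theorem zero_lt_inv_apply_pos (hw : ∀ i, 0 < rootValue w i) (j : Fin n) :
    0 < (w.1⁻¹ (PM.pos j) : ℤ) := by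
  have hzero := rootValue_pos_iff.1 (hw ⟨0, j.pos⟩)
  have hle := (strictMono_inv_apply_pos hw).monotone (a := ⟨0, j.pos⟩) (b := j) (Nat.zero_le _)
  rw [simplePerm_pos_zero rfl, inv_apply_neg, ← Subtype.coe_lt_coe, PM.coe_neg] at hzero
  rw [← Subtype.coe_le_coe] at hle
  omega

theorem eq_one_of_forall_rootValue_pos (hw : ∀ i, 0 < rootValue w i) : w = 1 := by
  choose g hg using fun j => PM.exists_pos_eq (zero_lt_inv_apply_pos hw j)
  have hmono : StrictMono g := fun i j hij => by
    rw [← PM.strictMono_pos.lt_iff_lt, hg, hg]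
    exact strictMono_inv_apply_pos hw hij
  have hfix (j : Fin n) : w.1⁻¹ (PM.pos j) = PM.pos j := by
    rw [← hg, hmono.apply_le.antisymm hmono.le_apply]
  rw [← inv_eq_one]
  refine Subtype.ext (Equiv.ext fun k => ?_)
  change w.1⁻¹ k = k
  obtain ⟨j, rfl | rfl⟩ := k.eq_pos_or_eq_neg_pos
  · exact hfix j
  · rw [inv_apply_neg, hfix]

theorem rootValue_ne_zero : rootValue w i ≠ 0 := by
  rw [rootValue, sub_ne_zero, Subtype.coe_ne_coe, w.1⁻¹.injective.ne_iff]
  exact (simplePerm_pos_lt i).ne'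

theorem toColex_inv_apply_pos_lt_simpleB_mul (h : ¬0 < rootValue w i) :
    toColex (fun j => w.1⁻¹ (PM.pos j)) < toColex fun j => (simpleB n i * w).1⁻¹ (PM.pos j) := by
  refine ⟨i, fun j (hj : i < j) => ?_, ?_⟩
  · change w.1⁻¹ (PM.pos j) = (simpleB n i * w).1⁻¹ (PM.pos j)
    rw [simpleB_mul_inv_apply, simplePerm_pos_of_ne (by omega) (by omega)]
  · change w.1⁻¹ (PM.pos i) < (simpleB n i * w).1⁻¹ (PM.pos i)
    rw [simpleB_mul_inv_apply, ← Subtype.coe_lt_coe, ← sub_neg]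
    exact lt_of_le_of_ne (not_lt.1 h) rootValue_ne_zero

theorem closure_range_simpleB : Submonoid.closure (Set.range (simpleB n)) = ⊤ := by
  refine eq_top_iff.2 fun w _ => ?_
  -- An element maximal among the `v` such that `w ∈ ⟨s_0, …, s_{n-1}⟩ v` has no descents.
  obtain ⟨v, ⟨u, hu, huv⟩, hmax⟩ := Set.Finite.exists_maximalFor
    (fun v : hyperoctahedralGroup n => toColex fun j => v.1⁻¹ (PM.pos j))
    {v | ∃ u ∈ Submonoid.closure (Set.range (simpleB n)), u * v = w} (Set.toFinite _)
    ⟨w, 1, one_mem _, one_mul w⟩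
  obtain rfl : v = 1 := eq_one_of_forall_rootValue_pos fun i => by
    by_contra h
    have hlt := toColex_inv_apply_pos_lt_simpleB_mul h
    refine hlt.not_ge (hmax ⟨u * simpleB n i, ?_, ?_⟩ hlt.le)
    · exact mul_mem hu (Submonoid.subset_closure (Set.mem_range_self i))
    · rw [mul_assoc, ← mul_assoc (simpleB n i), simpleB_mul_self, one_mul, huv]
  rwa [← huv, mul_one]

theorem isHalfSpaceSystem_simpleB :
    IsHalfSpaceSystem (simpleB n) fun i => {w | 0 < rootValue w i} where
  mul_self := simpleB_mul_self
  closure_range := closure_range_simpleB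
  one_mem i := rootValue_pos_iff.2 (simplePerm_pos_lt i)
  mul_notMem {i w} (hw : 0 < rootValue w i) := by
    simpa only [Set.mem_ofPred_eq, rootValue_simpleB_mul_self, Left.neg_pos_iff] using hw.not_gt
  exchange := simpleB_exchange

theorem mem_Des_simpleB_iff : i ∈ Des (simpleB n) w ↔ rootValue w i ≤ 0 := by
  rw [isHalfSpaceSystem_simpleB.mem_Des_iff, Set.mem_ofPred_eq, not_lt]

end HalfSpacesB

section DihedralPairs

variable {n : ℕ} {i j : Fin n}

-- The next three lemmas are the formula `s_j α_i = α_i - ⟨α_i, α_j^∨⟩ α_j` in the three cases.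
theorem rootValue_simpleB_mul_of_add_two_le (hij : (i : ℕ) + 2 ≤ j) (w : hyperoctahedralGroup n) :
    rootValue (simpleB n j * w) i = rootValue w i ∧
      rootValue (simpleB n i * w) j = rootValue w j := by
  obtain ⟨p, hp⟩ : ∃ p : Fin n, (j : ℕ) = p + 1 := ⟨⟨j - 1, by omega⟩, by simp only; omega⟩
  have hfix : simplePerm j (simplePerm i (PM.pos i)) = simplePerm i (PM.pos i) := by
    rcases Nat.eq_zero_or_pos (i : ℕ) with hi | hi
    · rw [simplePerm_pos_zero hi, simplePerm_neg, simplePerm_pos_of_ne (by omega) (by omega)]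
    · rw [simplePerm_pos_succ (i := ⟨i - 1, by omega⟩) (by simp only; omega),
        simplePerm_pos_of_ne (by simp only; omega) (by simp only; omega)]
  simp only [rootValue, simpleB_mul_inv_apply, hfix, simplePerm_pos_succ hp,
    simplePerm_pos_of_ne (i := p) (j := i) (by omega) (by omega),
    simplePerm_pos_of_ne (i := i) (j := j) (by omega) (by omega),
    simplePerm_pos_of_ne (i := j) (j := i) (by omega) (by omega), and_self]

theorem rootValue_simpleB_mul_of_eq_succ (hi : (i : ℕ) ≠ 0) (hij : (j : ℕ) = i + 1)
    (w : hyperoctahedralGroup n) :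
    rootValue (simpleB n j * w) i = rootValue w i + rootValue w j ∧
      rootValue (simpleB n i * w) j = rootValue w i + rootValue w j := by
  obtain ⟨p, hp⟩ : ∃ p : Fin n, (i : ℕ) = p + 1 := ⟨⟨i - 1, by omega⟩, by simp only; omega⟩
  simp only [rootValue, simpleB_mul_inv_apply, simplePerm_pos_succ hij, simplePerm_pos_pred hij,
    simplePerm_pos_succ hp, simplePerm_pos_of_ne (i := p) (j := j) (by omega) (by omega),
    simplePerm_pos_of_ne (i := j) (j := i) (by omega) (by omega)]
  omega

theorem rootValue_simpleB_mul_of_zero_one (hi : (i : ℕ) = 0) (hj : (j : ℕ) = 1)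
    (w : hyperoctahedralGroup n) :
    rootValue (simpleB n j * w) i = rootValue w i + 2 * rootValue w j ∧
      rootValue (simpleB n i * w) j = rootValue w i + rootValue w j := by
  simp only [rootValue, simplePerm_pos_zero hi, simplePerm_pos_succ (i := i) (j := j) (by omega),
    simpleB_mul_inv_apply, simplePerm_pos_pred (i := i) (j := j) (by omega),
    simplePerm_pos_of_ne (i := j) (j := i) (by omega) (by omega), inv_apply_neg, PM.coe_neg]
  omega

theorem isDihedralPair_two (hij : (i : ℕ) + 2 ≤ j) : IsDihedralPair (simpleB n) 2 i j := by
  have hroot := rootValue_simpleB_mul_of_add_two_le hij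
  constructor <;> intro w <;>
    simp only [ClimbsToTop, mem_Des_simpleB_iff, hroot, rootValue_simpleB_mul_self,
      Nat.exists_lt_succ_right, Nat.not_lt_zero, false_and, exists_false] <;> omega

theorem isDihedralPair_three (hi : (i : ℕ) ≠ 0) (hij : (j : ℕ) = i + 1) :
    IsDihedralPair (simpleB n) 3 i j := by
  have hroot := rootValue_simpleB_mul_of_eq_succ hi hij
  constructor <;> intro w <;>
    simp only [ClimbsToTop, mem_Des_simpleB_iff, hroot, rootValue_simpleB_mul_self,
      Nat.exists_lt_succ_right, Nat.not_lt_zero, false_and, exists_false] <;> omega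

theorem isDihedralPair_four (hi : (i : ℕ) = 0) (hj : (j : ℕ) = 1) :
    IsDihedralPair (simpleB n) 4 i j := by
  have hroot := rootValue_simpleB_mul_of_zero_one hi hj
  constructor <;> intro w <;>
    simp only [ClimbsToTop, mem_Des_simpleB_iff, hroot, rootValue_simpleB_mul_self,
      Nat.exists_lt_succ_right, Nat.not_lt_zero, false_and, exists_false] <;> omega

end DihedralPairs

section HeckeAction

variable {n : ℕ} {X : Set (hyperoctahedralGroup n)}

theorem HeckeB.adjoin_range_gen : Algebra.adjoin ℂ (Set.range (HeckeB.gen (n := n))) = ⊤ := by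
  have hgen : Set.range (HeckeB.gen (n := n)) =
      RingQuot.mkAlgHom ℂ (HeckeBRel n) '' Set.range (FreeAlgebra.ι ℂ) := by
    rw [← Set.range_comp]
    rfl
  rw [hgen, ← AlgHom.map_adjoin, FreeAlgebra.adjoin_range_ι, Algebra.map_top,
    AlgHom.range_eq_top]
  exact RingQuot.mkAlgHom_surjective ℂ _

/-- The representation of `H_n^B(0)` on `ℂX` by the operators `π_i`. -/
def heckeRep (hX : AscentCompatible (simpleB n) X) : HeckeB n →ₐ[ℂ] Module.End ℂ (X →₀ ℂ) :=
  RingQuot.liftAlgHom ℂ ⟨FreeAlgebra.lift ℂ (piOp (simpleB n) X), by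
    intro a b h
    cases h with
    | quad i => simpa using isHalfSpaceSystem_simpleB.piOp_mul_self
    | comm i j h =>
      simpa [alternatingProd_succ, alternatingProd_zero] using
        ((isDihedralPair_two h).alternatingProd_piOp_swap isHalfSpaceSystem_simpleB hX)
    | braid i j hi h =>
      simpa [alternatingProd_succ, alternatingProd_zero] using
        ((isDihedralPair_three (by omega) h).alternatingProd_piOp_swap isHalfSpaceSystem_simpleB
          hX).symm
    | braid₄ i j hi hj =>
      simpa [alternatingProd_succ, alternatingProd_zero] using
        (isDihedralPair_four hi hj).alternatingProd_piOp_swap isHalfSpaceSystem_simpleB hX⟩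

theorem heckeRep_gen (hX : AscentCompatible (simpleB n) X) (i : Fin n) :
    heckeRep hX (HeckeB.gen i) = piOp (simpleB n) X i := by
  simp [heckeRep, HeckeB.gen]

theorem piOp_single_apply_of_wordLength_le (i : Fin n) {x y : X}
    (hxy : wordLength (simpleB n) x.1 ≤ wordLength (simpleB n) y.1) :
    piOp (simpleB n) X i (Finsupp.single y 1) x =
      HeckeB.simpleChar (Des (simpleB n) x.1) (HeckeB.gen i) * Finsupp.single y (1 : ℂ) x := by
  rw [HeckeB.simpleChar_gen, ← basisVec_coe]
  by_cases hi : i ∈ Des (simpleB n) y.1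
  · rw [piOp_basisVec_of_mem_Des hi, basisVec_coe]
    obtain rfl | h := eq_or_ne y x
    · simp [hi]
    · simp [h]
  · have hlen := isHalfSpaceSystem_simpleB.wordLength_mul hi
    have hne : simpleB n i * y.1 ≠ x.1 := fun h => by rw [h] at hlen; omega
    have hzero : basisVec X (simpleB n i * y.1) x = 0 := by
      by_cases hmem : simpleB n i * y.1 ∈ X
      · simp [basisVec, hmem, Subtype.ext_iff, hne]
      · simp [basisVec_of_notMem hmem]
    rw [piOp_basisVec_of_notMem_Des y.2 hi, hzero, basisVec_coe]
    obtain rfl | h := eq_or_ne y x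
    · simp [hi]
    · simp [h]

theorem cls_ofRep_heckeRep [Fintype X] (hX : AscentCompatible (simpleB n) X) :
    (FDModule.ofRep (heckeRep hX)).cls =
      ∑ x : X, (simpleModuleB (Des (simpleB n) x.1)).cls := by
  refine FDModule.cls_eq_sum_of_triangular (M := FDModule.ofRep (heckeRep hX))
    (b := Finsupp.basisSingleOne) (len := fun x => wordLength (simpleB n) x.1)
    (χ := fun x => HeckeB.simpleChar (Des (simpleB n) x.1)) HeckeB.adjoin_range_gen ?_
  rintro _ ⟨i, rfl⟩ x y hxy
  change heckeRep hX (HeckeB.gen i) (Finsupp.basisSingleOne y) x =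
    _ * Finsupp.basisSingleOne (R := ℂ) y x
  rw [heckeRep_gen, Finsupp.coe_basisSingleOne]
  exact piOp_single_apply_of_wordLength_le i hxy

theorem QB_inv [Fintype X] : QB X⁻¹ = ∑ x : X, fundamentalB (Des (simpleB n) x.1) := by
  unfold QB
  rw [← Set.image_inv_eq_inv, finsum_mem_image inv_injective.injOn, ← finsum_set_coe_eq_finsum_mem,
    finsum_eq_sum_of_fintype]
  simp only [inv_inv]

theorem chB_ofRep_heckeRep (hX : AscentCompatible (simpleB n) X) :
    chB n (FDModule.ofRep (heckeRep hX)).cls = QB X⁻¹ := by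
  classical
  have := Fintype.ofFinite X
  simp only [cls_ofRep_heckeRep, map_sum, chB_simple, QB_inv]

end HeckeAction

section Words

variable {n : ℕ} {l l₁ l₂ m w w₁ w₂ : List ℤ} {x y : ℤ}

/-- The letters of `l` increase by `1` modulo `n` from each position to the next one. -/
def IsCyclicInterval (n : ℕ) (l : List ℤ) : Prop :=
  l.IsChain fun x y : ℤ => (y : ZMod n) = x + 1

/-- The absolute values of the letters of `w`: first those of the negative letters, from right to
left, then those of the positive letters, from left to right. In this order the conditions on signed
arc permutations say that the letters form a cyclic interval. -/
def absWord (w : List ℤ) : List ℤ :=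
  ((w.filter (· < 0)).map (-·)).reverse ++ w.filter (0 < ·)

theorem IsCyclicInterval.map_sub_eq {f : ℤ → ℤ} (hl : IsCyclicInterval n l)
    (hf : IsCyclicInterval n (l.map f)) (hx : x ∈ l) (hy : y ∈ l) :
    (f x - x : ZMod n) = f y - y := by
  rw [IsCyclicInterval, List.isChain_map] at hf
  have hchain : l.IsChain fun x y => (f x - x : ZMod n) = f y - y := by
    rw [IsCyclicInterval, List.isChain_iff_getElem] at hl
    rw [List.isChain_iff_getElem] at hf ⊢
    intro i hi
    rw [hl i hi, hf i hi]
    ring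
  let R (x y : ℤ) : Prop := (f x - x : ZMod n) = f y - y
  have : IsTrans ℤ R := ⟨fun _ _ _ => Eq.trans⟩
  have : Std.Symm R := ⟨fun _ _ => Eq.symm⟩
  exact List.Pairwise.forall_of_forall (R := R) (fun _ _ => rfl) hchain.pairwise hx hy

theorem IsCyclicInterval.cast_getLast (hl : IsCyclicInterval n (x :: l)) :
    (((x :: l).getLast (List.cons_ne_nil x l) : ℤ) : ZMod n) = x + l.length := by
  induction l generalizing x with
  | nil => simp
  | cons y l ih =>
    obtain ⟨hxy, hyl⟩ := List.isChain_cons_cons.1 hl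
    rw [List.getLast_cons (List.cons_ne_nil y l), ih hyl, hxy, List.length_cons]
    push_cast
    ring

theorem isCyclicInterval_move_left_iff (hlen : (l₁ ++ m ++ x :: l₂).length = n)
    (hl : IsCyclicInterval n (l₁ ++ m ++ x :: l₂)) :
    IsCyclicInterval n (l₁ ++ x :: m ++ l₂) ↔ m = [] ∨ l₁ = [] ∧ l₂ = [] := by
  obtain _ | ⟨y, m⟩ := m
  · simpa using hl
  have hmx : IsCyclicInterval n (y :: m ++ [x]) := hl.infix ⟨l₁, l₂, by simp⟩
  have hx : (x : ZMod n) = y + (m.length + 1) := by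
    simpa using IsCyclicInterval.cast_getLast hmx
  have hlen' : l₁.length + l₂.length + (m.length + 2) = n := by
    rw [← hlen]
    simp only [List.length_append, List.length_cons]
    omega
  have hn : (l₁.length + l₂.length + (m.length + 2) : ZMod n) = 0 := by
    rw [← ZMod.natCast_self n]
    exact_mod_cast congrArg (Nat.cast (R := ZMod n)) hlen'
  simp only [reduceCtorEq, false_or]
  constructor
  · intro h
    have hxy : (y : ZMod n) = x + 1 :=
      (List.isChain_cons_cons.1 (h.infix (l₁ := x :: y :: m) ⟨l₁, l₂, rfl⟩)).1
    have hdvd : n ∣ l₁.length + l₂.length := by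
      rw [← ZMod.natCast_eq_zero_iff]
      push_cast
      linear_combination hn + hx + hxy
    have := Nat.eq_zero_of_dvd_of_lt hdvd (by omega)
    simpa [← List.length_eq_zero_iff] using this
  · rintro ⟨rfl, rfl⟩
    rw [List.nil_append, List.append_nil]
    refine List.isChain_cons_cons.2 ⟨?_, hmx.prefix (List.prefix_append _ _)⟩
    simp only [List.length_nil, Nat.cast_zero, zero_add] at hn
    linear_combination -hn - hx

theorem mem_absWord : x ∈ absWord w ↔ 0 < x ∧ (x ∈ w ∨ -x ∈ w) := by
  simp only [absWord, List.mem_append, List.mem_reverse, List.mem_map, List.mem_filter,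
    decide_eq_true_iff]
  constructor
  · rintro (⟨y, ⟨hy, hneg⟩, rfl⟩ | ⟨hx, hpos⟩)
    · exact ⟨by omega, Or.inr (by rwa [neg_neg])⟩
    · exact ⟨hpos, Or.inl hx⟩
  · rintro ⟨hpos, hx | hx⟩
    · exact Or.inr ⟨hx, hpos⟩
    · exact Or.inl ⟨-x, ⟨hx, by omega⟩, by ring⟩

theorem length_absWord (hw : ∀ x ∈ w, x ≠ 0) : (absWord w).length = w.length := by
  rw [absWord, List.length_append, List.length_reverse, List.length_map,
    List.length_eq_length_filter_add (l := w) (· < 0)]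
  congr 2
  refine List.filter_congr fun x hx => ?_
  have := hw x hx
  simp only [← decide_not, decide_eq_decide]
  omega

theorem absWord_eq_nil_iff (hw : ∀ x ∈ w, x ≠ 0) : absWord w = [] ↔ w = [] := by
  rw [← List.length_eq_zero_iff, length_absWord hw, List.length_eq_zero_iff]

theorem nodup_absWord (hw : w.Nodup) (hneg : ∀ x ∈ w, -x ∉ w) : (absWord w).Nodup := by
  refine List.nodup_append.2 ⟨?_, hw.filter _, ?_⟩
  · exact List.nodup_reverse.2 ((hw.filter _).map neg_injective)
  · simp only [List.mem_reverse, List.mem_map, List.mem_filter]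
    rintro _ ⟨x, ⟨hx, -⟩, rfl⟩ y ⟨hy, -⟩ rfl
    exact hneg x hx hy

theorem absWord_map {f : ℤ → ℤ} (hneg : ∀ x, f (-x) = -f x) (hpos : ∀ x, 0 < f x ↔ 0 < x) :
    absWord (w.map f) = (absWord w).map f := by
  have hlt x : f x < 0 ↔ x < 0 := by rw [← neg_pos, ← hneg, hpos, neg_pos]
  simp only [absWord, List.filter_map, List.map_append, List.map_reverse, List.map_map,
    Function.comp_def, hneg, hpos, hlt]

theorem absWord_of_pos (hw : ∀ x ∈ w, 0 < x) : absWord w = w := by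
  rw [absWord, List.filter_eq_nil_iff.2, List.filter_eq_self.2]
  · rfl
  · exact fun x hx => decide_eq_true (hw x hx)
  · exact fun x hx => by simpa using (hw x hx).le

theorem absWord_neg_cons_of_pos (hx : 0 < x) (hw : ∀ y ∈ w, 0 < y) :
    absWord (-x :: w) = x :: w := by
  nth_rw 2 [← absWord_of_pos hw]
  have hneg : w.filter (· < 0) = [] :=
    List.filter_eq_nil_iff.2 fun y hy => by simpa using (hw y hy).le
  simp [absWord, hx, hx.not_gt, hneg]

theorem absWord_append_cons (hx : 0 < x) : absWord (w₁ ++ x :: w₂) =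
    ((w₂.filter (· < 0)).map (-·)).reverse ++ absWord w₁ ++ x :: w₂.filter (0 < ·) := by
  simp [absWord, hx, hx.not_gt]

theorem absWord_append_neg_cons (hx : 0 < x) : absWord (w₁ ++ -x :: w₂) =
    ((w₂.filter (· < 0)).map (-·)).reverse ++ x :: absWord w₁ ++ w₂.filter (0 < ·) := by
  simp [absWord, hx, hx.not_gt]

theorem isCyclicInterval_absWord_append_neg_cons_iff (hx : 0 < x) (hw₁ : ∀ y ∈ w₁, y ≠ 0)
    (hw₂ : ∀ y ∈ w₂, y ≠ 0) (hlen : (w₁ ++ x :: w₂).length = n)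
    (h : IsCyclicInterval n (absWord (w₁ ++ x :: w₂))) :
    IsCyclicInterval n (absWord (w₁ ++ -x :: w₂)) ↔ w₁ = [] ∨ w₂ = [] := by
  have hnil₂ : ((w₂.filter (· < 0)).map (-·)).reverse = [] ∧ w₂.filter (0 < ·) = [] ↔
      w₂ = [] := by
    rw [← List.append_eq_nil_iff, ← absWord, absWord_eq_nil_iff hw₂]
  have hlen_abs : (absWord (w₁ ++ x :: w₂)).length = n := by
    rw [length_absWord, hlen]
    grind
  rw [absWord_append_cons hx] at h hlen_abs
  rw [absWord_append_neg_cons hx, isCyclicInterval_move_left_iff hlen_abs h,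
    absWord_eq_nil_iff hw₁, hnil₂]

theorem isShuffle_iff (hl₁ : ∀ x ∈ l₁, 0 < x) (hl₂ : ∀ x ∈ l₂, x < 0) (hw : ∀ x ∈ w, x ≠ 0) :
    IsShuffle l₁ l₂ w ↔ w.filter (0 < ·) = l₁ ∧ w.filter (· < 0) = l₂ := by
  have hfilter (p q : ℤ → Prop) [DecidablePred p] [DecidablePred q] (h : ∀ x ∈ w, (p x ↔ q x)) :
      w.filter p = w.filter q := List.filter_congr fun x hx => decide_eq_decide.2 (h x hx)
  constructor
  · rintro ⟨h₁, h₂⟩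
    have hmem (x : ℤ) (hx : x ∈ w) : x ∈ l₁ ∨ x ∈ l₂ := by
      refine or_iff_not_imp_right.2 fun hx₂ => ?_
      simp [← h₁, hx, hx₂]
    constructor
    · refine (hfilter _ _ fun x hx => ?_).trans h₁
      grind [hmem _ hx]
    · refine (hfilter _ _ fun x hx => ?_).trans h₂
      grind [hmem _ hx]
  · rintro ⟨rfl, rfl⟩
    constructor <;> refine hfilter _ _ fun x hx => ?_ <;> have := hw x hx <;> grind

end Words

section OneLine

variable {n : ℕ} {i j : Fin n} {u v : hyperoctahedralGroup n} {k : PM n} {x : ℤ}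

theorem length_oneLine (u : hyperoctahedralGroup n) : (oneLine u).length = n := by
  simp [oneLine]

theorem mem_oneLine : x ∈ oneLine u ↔ ∃ j, (u.1 (PM.pos j) : ℤ) = x := by
  rw [oneLine, List.mem_ofFn]

theorem coe_mem_oneLine_iff : (k : ℤ) ∈ oneLine u ↔ 0 < (u.1⁻¹ k : ℤ) := by
  rw [mem_oneLine]
  constructor
  · rintro ⟨j, hj⟩
    rw [Equiv.Perm.inv_eq_iff_eq.2 (Subtype.ext hj).symm, PM.coe_pos]
    omega
  · intro hk
    obtain ⟨j, hj⟩ := PM.exists_pos_eq hk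
    exact ⟨j, congrArg Subtype.val (Equiv.Perm.eq_inv_iff_eq.1 hj)⟩

theorem ne_zero_of_mem_oneLine (hx : x ∈ oneLine u) : x ≠ 0 := by
  obtain ⟨j, rfl⟩ := mem_oneLine.1 hx
  exact (PM.bounds _).2.2

theorem neg_notMem_oneLine (hx : x ∈ oneLine u) : -x ∉ oneLine u := by
  obtain ⟨j, rfl⟩ := mem_oneLine.1 hx
  rw [coe_mem_oneLine_iff] at hx
  rw [← PM.coe_neg, coe_mem_oneLine_iff, inv_apply_neg, PM.coe_neg]
  omega

theorem nodup_oneLine (u : hyperoctahedralGroup n) : (oneLine u).Nodup := by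
  rw [oneLine, List.nodup_ofFn]
  exact Subtype.coe_injective.comp (u.1.injective.comp PM.strictMono_pos.injective)

theorem oneLine_simpleB_mul (i : Fin n) (u : hyperoctahedralGroup n) :
    oneLine (simpleB n i * u) = (oneLine u).map (simpleVal i) := by
  rw [oneLine, oneLine, List.map_ofFn]
  exact congrArg List.ofFn (funext fun j => coe_simplePerm i _)

theorem exists_oneLine_eq_append_cons (hk : 0 < (u.1⁻¹ k : ℤ)) :
    ∃ w₁ w₂, oneLine u = w₁ ++ (k : ℤ) :: w₂ ∧ (w₁.length : ℤ) + 1 = u.1⁻¹ k := by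
  obtain ⟨j, hj⟩ := PM.exists_pos_eq hk
  have hjn : (j : ℕ) < (oneLine u).length := (length_oneLine u).symm ▸ j.2
  have hget : (oneLine u)[(j : ℕ)] = k := by
    simp [oneLine, hj]
  refine ⟨(oneLine u).take j, (oneLine u).drop (j + 1), ?_, ?_⟩
  · rw [← hget, List.getElem_cons_drop, List.take_append_drop]
  · rw [List.length_take_of_le hjn.le, ← hj, PM.coe_pos]

theorem isShuffle_oneLine_iff {a b : List ℤ} (ha : ∀ x ∈ a, 0 < x) (hb : ∀ x ∈ b, x < 0) :
    IsShuffle a b (oneLine u) ↔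
      (oneLine u).filter (0 < ·) = a ∧ (oneLine u).filter (· < 0) = b :=
  isShuffle_iff ha hb fun _ => ne_zero_of_mem_oneLine

theorem mem_absWord_oneLine : x ∈ absWord (oneLine u) ↔ 1 ≤ x ∧ x ≤ n := by
  rw [mem_absWord]
  constructor
  · rintro ⟨hpos, hx | hx⟩ <;>
    · obtain ⟨j, hj⟩ := mem_oneLine.1 hx
      have := (u.1 (PM.pos j)).bounds
      omega
  · rintro ⟨hx₁, hxn⟩
    let k : PM n := PM.pos ⟨x.toNat - 1, by omega⟩
    have hk : (k : ℤ) = x := by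
      simp only [k, PM.coe_pos]
      omega
    refine ⟨hx₁, ?_⟩
    rw [← hk, ← PM.coe_neg, coe_mem_oneLine_iff, coe_mem_oneLine_iff, inv_apply_neg, PM.coe_neg]
    have := (u.1⁻¹ k).bounds
    omega

theorem isCyclicInterval_absWord_iff {w : List ℤ} : IsCyclicInterval n (absWord w) ↔
    (w.filter (0 < ·)).IsChain (fun x x' => x' ≡ x + 1 [ZMOD n]) ∧
    (w.filter (· < 0)).IsChain (fun y y' => y' ≡ y + 1 [ZMOD n]) ∧
    ∀ x ∈ (w.filter (0 < ·)).head?, ∀ y ∈ (w.filter (· < 0)).head?, x ≡ -y + 1 [ZMOD n] := by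
  have hneg (y y' : ℤ) : y' ≡ y + 1 [ZMOD n] ↔ -y ≡ -y' + 1 [ZMOD n] := by
    simp only [Int.modEq_iff_dvd]
    ring_nf
  simp only [IsCyclicInterval, absWord, List.isChain_append, List.isChain_reverse, List.isChain_map,
    ← Int.cast_one (R := ZMod n), ← Int.cast_add, ZMod.intCast_eq_intCast_iff, ← hneg,
    List.getLast?_reverse, List.head?_map, Option.mem_map, forall_exists_index, and_imp,
    forall_apply_eq_imp_iff₂]
  grind

theorem mem_signedArc_iff : u ∈ signedArc n ↔ IsCyclicInterval n (absWord (oneLine u)) := by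
  rw [isCyclicInterval_absWord_iff]
  constructor
  · rintro ⟨a, b, ha, hb, hab, hcyc⟩
    obtain ⟨rfl, rfl⟩ := (isShuffle_oneLine_iff (fun x hx => (ha x hx).1)
      fun y hy => Int.lt_of_le_sub_one (hb y hy).2).1 hab
    exact hcyc
  · intro hcyc
    have hmem {x : ℤ} (hx : x ∈ oneLine u) : -(n : ℤ) ≤ x ∧ x ≤ n := by
      obtain ⟨j, rfl⟩ := mem_oneLine.1 hx
      exact ⟨(PM.bounds _).1, (PM.bounds _).2.1⟩
    refine ⟨_, _, fun x hx => ?_, fun y hy => ?_,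
      (isShuffle_oneLine_iff (fun x hx => ?_) fun y hy => ?_).2 ⟨rfl, rfl⟩, hcyc⟩
    all_goals grind

theorem signedArc_eq_univ (hn : n ≤ 2) : signedArc n = Set.univ := by
  refine Set.eq_univ_of_forall fun u => mem_signedArc_iff.2 ?_
  refine (List.Pairwise.imp_of_mem ?_
    (nodup_absWord (nodup_oneLine u) fun _ => neg_notMem_oneLine)).isChain
  intro x y hx hy hxy
  rw [mem_absWord_oneLine] at hx hy
  obtain rfl : n = 2 := by omega
  obtain ⟨rfl, rfl⟩ | ⟨rfl, rfl⟩ : x = 1 ∧ y = 2 ∨ x = 2 ∧ y = 1 := by omega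
  all_goals decide

end OneLine

section AscentCompatible

variable {n : ℕ} {i j : Fin n} {u v : hyperoctahedralGroup n}

theorem simpleVal_neg (i : ℕ) (x : ℤ) : simpleVal i (-x) = -simpleVal i x := by
  grind [simpleVal]

theorem simpleVal_pos_iff {i : ℕ} (hi : i ≠ 0) (x : ℤ) : 0 < simpleVal i x ↔ 0 < x := by
  grind [simpleVal]

theorem oneLine_simpleB_zero_mul {w₁ w₂ : List ℤ} (hi : (i : ℕ) = 0)
    (hw : oneLine u = w₁ ++ 1 :: w₂) : oneLine (simpleB n i * u) = w₁ ++ -1 :: w₂ := by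
  have hnodup := nodup_oneLine u
  have hneg : -1 ∉ oneLine u := neg_notMem_oneLine (by simp [hw])
  have hfix {x : ℤ} (hx : x ≠ 1) (hx' : x ≠ -1) : simpleVal 0 x = x := by
    simp [simpleVal, hx, hx']
  have hmap {w : List ℤ} (h : 1 ∉ w) (h' : -1 ∉ w) : w.map (simpleVal 0) = w :=
    (List.map_congr_left fun x hx =>
      hfix (ne_of_mem_of_not_mem hx h) (ne_of_mem_of_not_mem hx h')).trans w.map_id
  rw [oneLine_simpleB_mul, hi]
  rw [hw] at hnodup hneg ⊢
  have hone : 1 ∉ w₁ ++ w₂ := (List.nodup_cons.1 (List.nodup_middle.1 hnodup)).1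
  rw [List.map_append, List.map_cons, hmap (by grind) (by grind), hmap (by grind) (by grind)]
  rfl

theorem simpleB_mul_notMem_signedArc (hn : 3 ≤ n) (hu : u ∈ signedArc n) (hi : (i : ℕ) ≠ 0) :
    simpleB n i * u ∉ signedArc n := by
  intro hsu
  rw [mem_signedArc_iff] at hu hsu
  rw [oneLine_simpleB_mul, absWord_map (simpleVal_neg i) (simpleVal_pos_iff hi)] at hsu
  have hshift := hu.map_sub_eq hsu (x := i) (y := i + 1) (mem_absWord_oneLine.2 (by omega))
    (mem_absWord_oneLine.2 (by omega))
  have hleft : simpleVal i i = i + 1 := by simp [simpleVal, hi]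
  have hright : simpleVal i (i + 1) = i := by simp [simpleVal, hi]
  rw [hleft, hright] at hshift
  have htwo : ((2 : ℕ) : ZMod n) = 0 := by
    push_cast at hshift ⊢
    linear_combination hshift
  have := Nat.le_of_dvd two_pos ((ZMod.natCast_eq_zero_iff 2 n).1 htwo)
  omega

theorem notMem_Des_iff_of_eq_zero (hi : (i : ℕ) = 0) :
    i ∉ Des (simpleB n) u ↔ 0 < (u.1⁻¹ (PM.pos i) : ℤ) := by
  rw [mem_Des_simpleB_iff, rootValue, simplePerm_pos_zero hi, inv_apply_neg, PM.coe_neg]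
  omega

theorem simpleB_zero_mul_mem_signedArc_iff (hi : (i : ℕ) = 0) (hdes : i ∉ Des (simpleB n) u)
    (hu : u ∈ signedArc n) :
    simpleB n i * u ∈ signedArc n ↔
      (u.1⁻¹ (PM.pos i) : ℤ) = 1 ∨ (u.1⁻¹ (PM.pos i) : ℤ) = n := by
  obtain ⟨w₁, w₂, hw, hpos⟩ :=
    exists_oneLine_eq_append_cons ((notMem_Des_iff_of_eq_zero hi).1 hdes)
  have hone : (PM.pos i : ℤ) = 1 := by rw [PM.coe_pos, hi]; rfl
  rw [hone] at hw
  have hlen := hw ▸ length_oneLine u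
  have hne {x : ℤ} (hx : x ∈ w₁ ++ 1 :: w₂) : x ≠ 0 := ne_zero_of_mem_oneLine (hw ▸ hx)
  rw [mem_signedArc_iff, hw] at hu
  rw [mem_signedArc_iff, oneLine_simpleB_zero_mul hi hw,
    isCyclicInterval_absWord_append_neg_cons_iff one_pos (fun y hy => hne (by simp [hy]))
      (fun y hy => hne (by simp [hy])) hlen hu,
    ← hpos, ← List.length_eq_zero_iff, ← List.length_eq_zero_iff]
  rw [List.length_append, List.length_cons] at hlen
  omega

theorem eq_zero_and_eq_or_eq_of_simplePerm_eq_neg {k : PM n} (h : simplePerm j k = -k) :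
    (j : ℕ) = 0 ∧ (k = PM.pos j ∨ k = -PM.pos j) := by
  have := k.bounds
  simp only [Subtype.ext_iff, coe_simplePerm, PM.coe_neg, PM.coe_pos] at h ⊢
  grind [simpleVal]

theorem inv_apply_pos_eq_of_aligned (h : Aligned (simpleB n) u v i j) (hi : (i : ℕ) = 0) :
    (j : ℕ) = 0 ∧ v.1⁻¹ (PM.pos j) = u.1⁻¹ (PM.pos i) := by
  obtain ⟨hui, hvj, huv⟩ := h
  obtain ⟨k, hk⟩ : ∃ k, u.1⁻¹ (PM.pos i) = k := ⟨_, rfl⟩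
  rw [notMem_Des_iff_of_eq_zero hi, hk] at hui
  have hneg : simplePerm j (v.1 k) = -v.1 k := by
    have hconj : v * (u⁻¹ * simpleB n i * u) = simpleB n j * v := by
      rw [huv]
      group
    have happly := DFunLike.congr_fun (congrArg Subtype.val hconj) k
    change v.1 (u.1⁻¹ (simplePerm i (u.1 k))) = simplePerm j (v.1 k) at happly
    rw [← happly, ← Equiv.Perm.inv_eq_iff_eq.1 hk, simplePerm_pos_zero hi, inv_apply_neg, hk, v.2]
  obtain ⟨hj, hpos | hpos⟩ := eq_zero_and_eq_or_eq_of_simplePerm_eq_neg hneg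
  · exact ⟨hj, by rw [hk, Equiv.Perm.inv_eq_iff_eq, hpos]⟩
  · rw [notMem_Des_iff_of_eq_zero hj, ← PM.neg_neg (PM.pos j), ← hpos, ← v.2,
      Equiv.Perm.inv_eq_iff_eq.2 rfl, PM.coe_neg] at hvj
    omega

theorem ascentCompatible_signedArc : AscentCompatible (simpleB n) (signedArc n) := by
  rcases le_or_gt n 2 with hn | hn
  · rw [signedArc_eq_univ hn]
    exact fun _ _ _ _ _ _ _ => Iff.rfl
  suffices H : ∀ u ∈ signedArc n, ∀ v ∈ signedArc n, ∀ i j, Aligned (simpleB n) u v i j →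
      simpleB n i * u ∈ signedArc n → simpleB n j * v ∈ signedArc n from
    fun u hu v hv i j h => ⟨H u hu v hv i j h, H v hv u hu j i ⟨h.2.1, h.1, h.2.2.symm⟩⟩
  intro u hu v hv i j h hmem
  have hi : (i : ℕ) = 0 := by
    by_contra hi
    exact simpleB_mul_notMem_signedArc hn hu hi hmem
  obtain ⟨hj, hinv⟩ := inv_apply_pos_eq_of_aligned h hi
  rw [simpleB_zero_mul_mem_signedArc_iff hi h.1 hu] at hmem
  rwa [simpleB_zero_mul_mem_signedArc_iff hj h.2.1 hv, hinv]

end AscentCompatible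

section NotConvex

theorem IsHalfSpaceSystem.leftWeakLE_mul {W ι : Type*} [Group W] {s : ι → W} {P : ι → Set W}
    (hP : IsHalfSpaceSystem s P) {i : ι} {x y : W} (h : LeftWeakLE s x y) (hi : i ∉ Des s y) :
    LeftWeakLE s x (s i * y) := by
  obtain ⟨l₁, l₂, hy, hx⟩ := h
  exact ⟨i :: l₁, l₂, hP.isReducedWord_cons hy hi, hx⟩

variable {n k m : ℕ} {i j : Fin n}

/-- The element `s_{k-1} ⋯ s_1 s_0`, which has one-line notation `-k, 1, …, k-1, k+1, …, n`
for `1 ≤ k ≤ n`. -/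
def descendingProd (n : ℕ) : ℕ → hyperoctahedralGroup n
  | 0 => 1
  | k + 1 => if hk : k < n then simpleB n ⟨k, hk⟩ * descendingProd n k else descendingProd n k

theorem descendingProd_succ (hk : k < n) :
    descendingProd n (k + 1) = simpleB n ⟨k, hk⟩ * descendingProd n k := by
  rw [descendingProd, dif_pos hk]

theorem descendingProd_inv_apply_pos_of_le (hj : k ≤ j) :
    (descendingProd n k).1⁻¹ (PM.pos j) = PM.pos j := by
  induction k with
  | zero => rfl
  | succ k ih =>
    rw [descendingProd_succ (by omega), simpleB_mul_inv_apply,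
      simplePerm_pos_of_ne (by simp only; omega) (by simp only; omega), ih (by omega)]

theorem descendingProd_inv_apply_simplePerm (j : Fin n) :
    (descendingProd n j).1⁻¹ (simplePerm j (PM.pos j)) = -PM.pos ⟨0, j.pos⟩ := by
  obtain ⟨k, hk⟩ := j
  simp only
  induction k with
  | zero =>
    rw [simplePerm_pos_zero rfl, inv_apply_neg]
    rfl
  | succ k ih =>
    rw [simplePerm_pos_succ (i := ⟨k, by omega⟩) rfl, descendingProd_succ (by omega),
      simpleB_mul_inv_apply, ih]

theorem notMem_Des_descendingProd (j : Fin n) : j ∉ Des (simpleB n) (descendingProd n j) := by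
  rw [mem_Des_simpleB_iff, rootValue, descendingProd_inv_apply_pos_of_le le_rfl,
    descendingProd_inv_apply_simplePerm, PM.coe_neg, PM.coe_pos, PM.coe_pos]
  omega

theorem leftWeakLE_descendingProd (hmk : m ≤ k) :
    LeftWeakLE (simpleB n) (descendingProd n m) (descendingProd n k) := by
  induction k, hmk using Nat.le_induction with
  | base =>
    obtain ⟨l, hl⟩ := exists_isReducedWord closure_range_simpleB (descendingProd n m)
    exact ⟨[], l, hl, hl⟩
  | succ k _ ih =>
    rw [descendingProd]
    split_ifs with hk
    · exact isHalfSpaceSystem_simpleB.leftWeakLE_mul ih (notMem_Des_descendingProd ⟨k, hk⟩)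
    · exact ih

theorem descendingProd_inv_apply_pos_of_lt (hij : (j : ℕ) = i + 1) (hjk : (j : ℕ) < k)
    (hk : k ≤ n) : (descendingProd n k).1⁻¹ (PM.pos i) = PM.pos j := by
  induction k, hjk using Nat.le_induction with
  | base =>
    rw [descendingProd_succ j.2, simpleB_mul_inv_apply, simplePerm_pos_pred hij,
      descendingProd_inv_apply_pos_of_le le_rfl]
  | succ k hjk ih =>
    rw [descendingProd_succ (by omega), simpleB_mul_inv_apply,
      simplePerm_pos_of_ne (by simp only; omega) (by simp only; omega), ih (by omega)]

theorem oneLine_descendingProd_self (n : ℕ) : oneLine (descendingProd (n + 1) (n + 1)) =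
    -((n : ℤ) + 1) :: List.ofFn fun j : Fin n => (j : ℤ) + 1 := by
  have hzero : (descendingProd (n + 1) (n + 1)).1 (PM.pos 0) = -PM.pos (Fin.last n) := by
    rw [← Equiv.Perm.eq_inv_iff_eq, inv_apply_neg, descendingProd_succ n.lt_succ_self,
      simpleB_mul_inv_apply]
    change PM.pos 0 = -(descendingProd (n + 1) (Fin.last n)).1⁻¹ (simplePerm (Fin.last n) _)
    rw [descendingProd_inv_apply_simplePerm, PM.neg_neg]
    rfl
  have hsucc (j : Fin n) :
      (descendingProd (n + 1) (n + 1)).1 (PM.pos j.succ) = PM.pos j.castSucc := by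
    rw [← Equiv.Perm.eq_inv_iff_eq,
      descendingProd_inv_apply_pos_of_lt (j := j.succ) (by simp) j.succ.2 le_rfl]
  simp only [oneLine, List.ofFn_succ, hzero, hsucc, PM.coe_neg, PM.coe_pos, Fin.val_last,
    Fin.val_castSucc]

theorem isCyclicInterval_ofFn (m n : ℕ) :
    IsCyclicInterval n (List.ofFn fun j : Fin m => (j : ℤ) + 1) := by
  rw [IsCyclicInterval, List.isChain_iff_getElem]
  simp

theorem one_mem_signedArc : (1 : hyperoctahedralGroup n) ∈ signedArc n := by
  have hone : oneLine (1 : hyperoctahedralGroup n) = List.ofFn fun j : Fin n => (j : ℤ) + 1 := rfl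
  rw [mem_signedArc_iff, hone, absWord_of_pos]
  · exact isCyclicInterval_ofFn n n
  · simp only [List.mem_ofFn, forall_exists_index]
    omega

theorem descendingProd_self_mem_signedArc (n : ℕ) :
    descendingProd (n + 1) (n + 1) ∈ signedArc (n + 1) := by
  rw [mem_signedArc_iff, oneLine_descendingProd_self, absWord_neg_cons_of_pos (by omega)]
  · refine List.isChain_cons.2 ⟨?_, isCyclicInterval_ofFn n (n + 1)⟩
    obtain _ | n := n
    · simp
    have := ZMod.natCast_self (n + 1 + 1)
    push_cast at this
    simp [List.ofFn_succ, this]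
  · simp only [List.mem_ofFn, forall_exists_index]
    omega

theorem not_leftWeakConvex_signedArc (hn : 3 ≤ n) :
    ¬LeftWeakConvex (simpleB n) (signedArc n) := by
  obtain ⟨n, rfl⟩ : ∃ m, n = m + 1 := ⟨n - 1, by omega⟩
  intro hconv
  have hone : descendingProd (n + 1) 1 ∈ signedArc (n + 1) := by
    rw [descendingProd_succ n.succ_pos]
    exact (simpleB_zero_mul_mem_signedArc_iff rfl (notMem_Des_descendingProd 0)
      one_mem_signedArc).2 (Or.inl rfl)
  have htwo : descendingProd (n + 1) 2 ∉ signedArc (n + 1) := by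
    rw [descendingProd_succ (by omega : 1 < n + 1)]
    exact simpleB_mul_notMem_signedArc hn hone one_ne_zero
  exact htwo (hconv _ one_mem_signedArc _ (descendingProd_self_mem_signedArc n)
    (leftWeakLE_descendingProd (m := 0) (Nat.zero_le _)) _
    (leftWeakLE_descendingProd (Nat.zero_le _)) (leftWeakLE_descendingProd (by omega)))

end NotConvex

end

theorem mainTheorem11 (n : ℕ) :
    AscentCompatible (simpleB n) (signedArc n) ∧
    (3 ≤ n → ¬ LeftWeakConvex (simpleB n) (signedArc n)) ∧
    ∃ ρ : HeckeB n →ₐ[ℂ] Module.End ℂ (signedArc n →₀ ℂ),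
      (∀ i : Fin n, ρ (HeckeB.gen i) = piOp (simpleB n) (signedArc n) i) ∧
      chB n (FDModule.ofRep ρ).cls = QB (signedArc n)⁻¹ :=
  ⟨ascentCompatible_signedArc, not_leftWeakConvex_signedArc, heckeRep ascentCompatible_signedArc,
    heckeRep_gen _, chB_ofRep_heckeRep _⟩
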